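/- **Robust leaky monogamy-of-entanglement entropic uncertainty relation.** Write $\lg$ for the base-two logarithm, with $-\lg 0=+\infty$, and $[x]=|x\rangle\langle x|$. Let $n\ge 2$ be an even integer and $V=\mathbb{Z}_2^n$. Let $A$ be the set of register subspaces of $V$ of dimension $n/2$, that is, the subspaces $a=\mathrm{span}\{e_i : i\in S\}$ with $S\subseteq\{1,\dots,n\}$, $|S|=n/2$. For such an $a$ and $t,t'\in\mathbb{Z}_2^{n/2}$, let $t_a\in V$ be $t$ written, in order, in the positions $i\notin S$ and $0$ elsewhere, let $t'_{a^\perp}\in V$ be $t'$ written, in order, in the positions $i\in S$ and $0$ elsewhere, and let $$|a_{t,t'}\rangle=\frac{1}{\sqrt{|a|}}\sum_{v\in a}(-1)^{v\cdot t'_{a^\perp}}\,|v+t_a\rangle$$ be the subspace coset state. Let $B,C$ be finite-dimensional quantum registers, $\Phi:\mathcal{L}(V)\to\mathcal{L}(BC)$ a quantum channel, $m\ge 0$ an integer, and $U=\{u\in\mathbb{Z}_2^{n/2} : |u|\le m\}$ the Hamming ball. With $T=T'=\mathbb{Z}_2^{n/2}$ and $A'$ a copy of $A$, let $$\sigma_{AA'TT'BC}=\mathbb{E}_{a\in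 A}\,\mathbb{E}_{t,t'\in\mathbb{Z}_2^{n/2}}\,\mathbb{E}_{u\in U}\;[a\,a\,t\,t']\otimes\Phi\big(|a_{t+u,t'}\rangle\langle a_{t+u,t'}|\big),$$ all expectations being uniform; equivalently $\sigma=\mathbb{E}_{u\in U}X^u_T\,\rho\,X^u_T$, where $\rho=\mathbb{E}_{a,t,t'}[a\,a\,t\,t']\otimes\Phi(|a_{t,t'}\rangle\langle a_{t,t'}|)$ and $X^u|t\rangle=|t+u\rangle$. Let $M=(M_t)_{t\in T}$ be any POVM on the compound register $AB$. Let $$\sigma_{\wedge(M(AB)=T)}=\sum_{t\in T}\big([t]_T\otimes\sqrt{M_t}_{AB}\big)\,\sigma\,\big([t]_T\otimes\sqrt{M_t}_{AB}\big)$$ be the partial state on the event that the outcome of $M$ equals $T$, let $\sigma_{|(M(AB)=T)}$ be its normalisation to trace one (taken to be $0$ if the event has probability $0$), and let $$H_{\min}(T|M(AB))_\sigma=-\lg\mathrm{Tr}\,\sigma_{\wedge(M(AB)=T)},\qquad H_{\min}(X|Y)_\tau=-\lg\inf\{\mathrm{Tr}\,\omega : \tau_{XY}\le \mathrm{Id}_X\otimes\omega,\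 0\le\omega\in\mathcal{L}(Y)\}.$$ Then $$H_{\min}(T|M(AB))_\sigma+H_{\min}(T'|A'TC)_{\sigma_{|(M(AB)=T)}}\;\ge\;\Big(-\lg\cos\tfrac{\pi}{8}-\tfrac{1}{(2\ln 2)\,n}\Big)n .$$ -/

import Mathlib

noncomputable section

namespace LeakyMoE

open scoped Kronecker MatrixOrder ComplexOrder

/-! ### Finite-dimensional quantum information

A register is a finite type `X`; operators on its Hilbert space are matrices `Matrix X X ℂ`, and
the compound register of `X` and `Y` is `X × Y`. -/

/-- `P` is a positive operator-valued measurement on `X` with outcomes in `S`. -/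
structure IsPOVM {S X : Type*} [Fintype S] [Fintype X] [DecidableEq X]
    (P : S → Matrix X X ℂ) : Prop where
  posSemidef : ∀ s, (P s).PosSemidef
  sum_eq_one : ∑ s, P s = 1

/-- The amplification `id_Z ⊗ Φ` of a linear map `Φ` on operators. -/
def amplify {X Y : Type*} (Z : Type*) (Φ : Matrix X X ℂ →ₗ[ℂ] Matrix Y Y ℂ)
    (P : Matrix (Z × X) (Z × X) ℂ) : Matrix (Z × Y) (Z × Y) ℂ :=
  fun i j => Φ (fun x x' => P (i.1, x) (j.1, x')) i.2 j.2

/-- `Φ` is a quantum channel: completely positive and trace preserving. -/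
structure IsChannel {X Y : Type*} [Fintype X] [Fintype Y]
    (Φ : Matrix X X ℂ →ₗ[ℂ] Matrix Y Y ℂ) : Prop where
  completelyPositive : ∀ (d : ℕ) (P : Matrix (Fin d × X) (Fin d × X) ℂ),
    P.PosSemidef → (amplify (Fin d) Φ P).PosSemidef
  tracePreserving : ∀ P : Matrix X X ℂ, P.PosSemidef → (Φ P).trace = P.trace

/-- The operator `|v⟩⟨v|`. -/
def ketbra {X : Type*} (v : X → ℂ) : Matrix X X ℂ := Matrix.vecMulVec v (star v)

/-- The classical state `[x] = |x⟩⟨x|`. -/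
def pt {X : Type*} [DecidableEq X] (x : X) : Matrix X X ℂ := Matrix.single x x 1

/-- Partial trace over the first register. -/
def traceFst {E X : Type*} [Fintype E] (ρ : Matrix (E × X) (E × X) ℂ) : Matrix X X ℂ :=
  fun i j => ∑ e, ρ (e, i) (e, j)

/-- The nondestructive measurement channel of `M`, applied to the middle register `Q` of a state on
`X Q R`: it gives `∑ s, [s] ⊗ √(M s) ρ √(M s)`, on the registers `S X Q R`. -/
def nondestructive {S X Q R : Type*} [Fintype S] [DecidableEq S] [Fintype X] [DecidableEq X]
    [Fintype Q] [DecidableEq Q] [Fintype R] [DecidableEq R]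
    (M : S → Matrix Q Q ℂ) (ρ : Matrix (X × Q × R) (X × Q × R) ℂ) :
    Matrix (S × X × Q × R) (S × X × Q × R) ℂ :=
  ∑ s, pt s ⊗ₖ
    (((1 : Matrix X X ℂ) ⊗ₖ (CFC.sqrt (M s) ⊗ₖ (1 : Matrix R R ℂ))) * ρ *
      ((1 : Matrix X X ℂ) ⊗ₖ (CFC.sqrt (M s) ⊗ₖ (1 : Matrix R R ℂ))))

/-- For a state on `X Q R` that is classical on `X`, the partial state on the event `M(Q) = X`:
measure `Q` nondestructively, keep the part of the state where the outcome equals the value of `X`,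
and forget the outcome. -/
def andGuess {X Q R : Type*} [Fintype X] [DecidableEq X]
    [Fintype Q] [DecidableEq Q] [Fintype R] [DecidableEq R]
    (M : X → Matrix Q Q ℂ) (ρ : Matrix (X × Q × R) (X × Q × R) ℂ) :
    Matrix (X × Q × R) (X × Q × R) ℂ :=
  traceFst (∑ x : X,
    (pt x ⊗ₖ (pt x ⊗ₖ (1 : Matrix (Q × R) (Q × R) ℂ))) * nondestructive M ρ *
      (pt x ⊗ₖ (pt x ⊗ₖ (1 : Matrix (Q × R) (Q × R) ℂ))))

/-- The conditional state given the event `M(Q) = X`. It is only meaningful when that event has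
nonzero probability (when it has probability zero, this is the zero operator). -/
def condGuess {X Q R : Type*} [Fintype X] [DecidableEq X]
    [Fintype Q] [DecidableEq Q] [Fintype R] [DecidableEq R]
    (M : X → Matrix Q Q ℂ) (ρ : Matrix (X × Q × R) (X × Q × R) ℂ) :
    Matrix (X × Q × R) (X × Q × R) ℂ :=
  (andGuess M ρ).trace⁻¹ • andGuess M ρ

/-! ### Entropies -/

/-- `-lg x` for `x ≥ 0`, with value `+∞` at `0`; `lg` is the base-two logarithm. -/
def negLg (x : ℝ) : EReal := if x ≤ 0 then ⊤ else ((-Real.logb 2 x : ℝ) : EReal)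

/-- `H_min(X | M(Q))_ρ`: minus the logarithm of the probability that the outcome of the measurement
`M` on `Q` is equal to the value of the classical register `X`. -/
def hMinMeas {X Q R : Type*} [Fintype X] [DecidableEq X]
    [Fintype Q] [DecidableEq Q] [Fintype R] [DecidableEq R]
    (M : X → Matrix Q Q ℂ) (ρ : Matrix (X × Q × R) (X × Q × R) ℂ) : EReal :=
  negLg (andGuess M ρ).trace.re

/-- The conditional min-entropy
`H_min(X | Y)_ρ = -lg inf {Tr ω | ρ ≤ 1_X ⊗ ω, ω ≥ 0}` of a state `ρ` on `X Y`. -/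
def hMin {X Y : Type*} [Fintype X] [DecidableEq X] [Fintype Y]
    (ρ : Matrix (X × Y) (X × Y) ℂ) : EReal :=
  negLg (sInf {r : ℝ | ∃ ω : Matrix Y Y ℂ, ω.PosSemidef ∧
    (((1 : Matrix X X ℂ) ⊗ₖ ω) - ρ).PosSemidef ∧ r = ω.trace.re})

/-! ### Register subspaces and subspace coset states -/

/-- Bit strings of length `n`. -/
abbrev Bits (n : ℕ) : Type := Fin n → ZMod 2

/-- The set of positions `i` such that the canonical basis vector `e_i` lies in `a`. -/
def support {n : ℕ} (a : Submodule (ZMod 2) (Bits n)) : Finset (Fin n) :=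
  open Classical in Finset.univ.filter fun i => (Pi.single i 1 : Bits n) ∈ a

/-- A register subspace: the span of a set of canonical basis vectors. -/
def IsRegisterSubspace {n : ℕ} (a : Submodule (ZMod 2) (Bits n)) : Prop :=
  ∃ S : Set (Fin n), a = Submodule.span (ZMod 2) ((fun i => (Pi.single i 1 : Bits n)) '' S)

/-- The register `A` of all register subspaces of dimension `k` of the bit strings of
length `2k`. -/
def RegSub (k : ℕ) : Type :=
  {a : Submodule (ZMod 2) (Bits (2 * k)) //
    IsRegisterSubspace a ∧ Module.finrank (ZMod 2) a = k}

instance (k : ℕ) : DecidableEq (RegSub k) := Classical.decEq _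

instance (k : ℕ) : Finite (RegSub k) :=
  inferInstanceAs (Finite {a : Submodule (ZMod 2) (Bits (2 * k)) //
    IsRegisterSubspace a ∧ Module.finrank (ZMod 2) a = k})

instance (k : ℕ) : Fintype (RegSub k) := Fintype.ofFinite _

theorem card_support {n : ℕ} {a : Submodule (ZMod 2) (Bits n)} (ha : IsRegisterSubspace a) :
    (support a).card = Module.finrank (ZMod 2) a := by
  classical
  obtain ⟨S, rfl⟩ := ha
  have hb : (fun i => (Pi.single i 1 : Bits n)) = Pi.basisFun (ZMod 2) (Fin n) := by
    funext i; simp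
  have h1 : support (Submodule.span (ZMod 2) ((fun i => (Pi.single i 1 : Bits n)) '' S))
      = S.toFinset := by
    ext i
    simp only [support, Finset.mem_filter, Finset.mem_univ, true_and, Set.mem_toFinset]
    rw [hb, ← Pi.basisFun_apply]
    exact (Pi.basisFun (ZMod 2) (Fin n)).self_mem_span_image
  rw [h1, hb, Set.image_eq_range, finrank_span_eq_card, Set.toFinset_card]
  exact (Pi.basisFun (ZMod 2) (Fin n)).linearIndependent.comp _ Subtype.val_injective

theorem RegSub.card_support {k : ℕ} (a : RegSub k) : (support a.1).card = k :=
  (LeakyMoE.card_support a.2.1).trans a.2.2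

theorem RegSub.card_support_compl {k : ℕ} (a : RegSub k) : (support a.1)ᶜ.card = k := by
  rw [Finset.card_compl, a.card_support, Fintype.card_fin]; omega

/-- The vector `∑ j, t_j e_{i_j}`, where `i_1 < ... < i_k` are the elements of `S`. -/
def place {n k : ℕ} (S : Finset (Fin n)) (h : S.card = k) (t : Bits k) : Bits n :=
  ∑ j, Pi.single (S.orderEmbOfFin h j) (t j)

/-- The subspace coset state `|a_{t,t'}⟩ = |a|^{-1/2} ∑_{u ∈ a} (-1)^{u ⬝ t'} |u + t⟩` for strings
`t, t'` of full length. -/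
def cosetVec {n : ℕ} (a : Submodule (ZMod 2) (Bits n)) (t t' : Bits n) : Bits n → ℂ :=
  open Classical in
  ((1 / Real.sqrt (Nat.card a) : ℝ) : ℂ) •
    ∑ u : Bits n, if u ∈ a then (-1 : ℂ) ^ (u ⬝ᵥ t').val • (Pi.single (u + t) 1 : Bits n → ℂ)
      else 0

/-- The subspace coset state `|a_{t,t'}⟩` for `t, t'` of half length. The subspace `a` is spanned by
the `e_i` with `i ∈ support a`, and its orthogonal subspace by the other `e_i`: the string `t` is
placed in the positions of the orthogonal subspace of `a`, and `t'` in the positions of `a`. -/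
def cosetState {k : ℕ} (a : RegSub k) (t t' : Bits k) : Bits (2 * k) → ℂ :=
  cosetVec a.1 (place (support a.1)ᶜ a.card_support_compl t) (place (support a.1) a.card_support t')

/-! ### The state of the robust leaky game -/

/-- The ball of radius `m` around `0` for the Hamming norm. -/
def ball (k m : ℕ) : Finset (Bits k) := Finset.univ.filter fun u => hammingNorm u ≤ m

/-- The state `𝔼_{a,t,t',u} [a a t t'] ⊗ Φ(|a_{t+u,t'}⟩⟨a_{t+u,t'}|)` on the registers
`A A' T T' B C`, with `a`, `t`, `t'` and `u ∈ ball k m` uniform and independent. -/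
def gameState {B C : Type*} (k m : ℕ)
    (Φ : Matrix (Bits (2 * k)) (Bits (2 * k)) ℂ →ₗ[ℂ] Matrix (B × C) (B × C) ℂ) :
    Matrix ((RegSub k × RegSub k × Bits k × Bits k) × (B × C))
      ((RegSub k × RegSub k × Bits k × Bits k) × (B × C)) ℂ :=
  ((Fintype.card (RegSub k) * Fintype.card (Bits k) * Fintype.card (Bits k) *
      (ball k m).card : ℂ))⁻¹ •
    ∑ a : RegSub k, ∑ t : Bits k, ∑ t' : Bits k, ∑ u ∈ ball k m,
      pt (a, a, t, t') ⊗ₖ Φ (ketbra (cosetState a (t + u) t'))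

/-- The same state with its registers grouped as `T (A B) (T' A' C)`. -/
def robustState {B C : Type*} (k m : ℕ)
    (Φ : Matrix (Bits (2 * k)) (Bits (2 * k)) ℂ →ₗ[ℂ] Matrix (B × C) (B × C) ℂ) :
    Matrix (Bits k × (RegSub k × B) × (Bits k × RegSub k × C))
      (Bits k × (RegSub k × B) × (Bits k × RegSub k × C)) ℂ :=
  (gameState k m Φ).submatrix
    (fun (t, (a, b), (t', a', c)) => ((a, a', t, t'), (b, c)))
    (fun (t, (a, b), (t', a', c)) => ((a, a', t, t'), (b, c)))

/-- The reduced state on `T' (A' T C)` of a state on `T (A B) (T' A' C)`: the registers `A B` are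
traced out. -/
def charlieView {T A B T' A' C : Type*} [Fintype A] [Fintype B]
    (ρ : Matrix (T × (A × B) × (T' × A' × C)) (T × (A × B) × (T' × A' × C)) ℂ) :
    Matrix (T' × (A' × T × C)) (T' × (A' × T × C)) ℂ :=
  traceFst (E := A × B) (ρ.submatrix
    (fun (ab, t', a', t, c) => (t, ab, t', a', c))
    (fun (ab, t', a', t, c) => (t, ab, t', a', c)))

end LeakyMoE

end

/-!
The two entropies add up to minus the logarithm of the best probability of the joint event that Bob
guesses `t` and that Charlie, who is told `a` and `t`, guesses `t'`. Strong duality for state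
discrimination (`exists_isPOVM_dominating`) supplies an optimal measurement of Charlie together with
an operator `ω` that dominates his states and whose trace is his guessing probability; so it is
enough to bound the value of a monogamy-of-entanglement game. The error `u` is harmless: for each
fixed `u` the players may relabel their outcomes by it (`shifted_game_value_le`), and the average
over `u` is at most the maximum.

Through the Choi operator of the channel, the value of the game is bounded by the norm of
`∑ₐ Πₐ / |A|`, where `Πₐ = ∑ |a_{t,t'}⟩⟨a_{t,t'}| ⊗ Mᵃ_t ⊗ Nᵃᵗ_{t'}` is the winning event for `a`.
A sum of positive operators is at most the largest row sum of the overlaps `‖√Πₐ √Π_b‖`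
(`sum_le_of_overlap`). For the overlap, `Πₐ` is enlarged to `K²`, where Charlie is dropped, and
`Π_b` to an operator `Q` in which Bob is dropped. Since Charlie is told `t`, the operator `Q` is
`∑_{s'} W_{s'} X_{s'} W_{s'}`: here `X_{s'}` projects onto the coset states of `b` with phase `s'`,
and `W_{s'}` is diagonal in the first register, hence commutes with `K`. As `∑ W_{s'}² = 1`, the
overlap is at most the square root of `‖X_{s'} K² X_{s'}‖`, which a count of bit strings bounds by
`2^{-d}` with `d` the number of positions in `b` but not in `a`
(`phaseProj_mul_outerProj_mul_phaseProj_le`).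

What remains is the mean of `2^{-d/2}` over `b`. It is a mean of products of `k` out of `2k` numbers,
half of them `1` and half of them `1/√2`, so a case of Maclaurin's inequality
(`sum_powersetCard_prod_le`) bounds it by `((1 + 1/√2)/2)ᵏ = cos(π/8)^{2k}`. This gives the bound
`-2k lg cos(π/8)`, which implies the stated one.
-/

noncomputable section

namespace LeakyMoE

open scoped Kronecker MatrixOrder ComplexOrder

/-! ### Sums of positive elements with small overlaps -/

section CStar

variable {R : Type*} [CStarAlgebra R] [PartialOrder R] [StarOrderedRing R]

/-- The operator form of `2 Re ⟨x ψ, T y ψ⟩ ≤ c (‖x ψ‖² + ‖y ψ‖²)`. -/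
theorem star_mul_mul_add_le {T : R} {c : ℝ} (hc : 0 < c) (hT : ‖T‖ ≤ c) (x y : R) :
    star x * T * y + star y * star T * x ≤ c • (star x * x + star y * y) := by
  have h1 : star y * (star T * T) * y ≤ c ^ 2 • (star y * y) := by
    have h := star_left_conjugate_le_conjugate
      ((CStarAlgebra.star_mul_le_algebraMap_norm_sq (a := T)).trans
        (algebraMap_mono R (pow_le_pow_left₀ (norm_nonneg T) hT 2))) y
    simpa [Algebra.algebraMap_eq_smul_one] using h
  -- Expand the square `|c x - T y|² ≥ 0`.
  have h2 : 0 ≤ star (c • x - T * y) * (c • x - T * y) := star_mul_self_nonneg _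
  have h3 : star (c • x - T * y) * (c • x - T * y) =
      c ^ 2 • (star x * x) + star y * (star T * T) * y -
        c • (star x * T * y + star y * star T * x) := by
    simp only [star_sub, star_smul, star_mul, star_trivial, sub_mul, mul_sub, smul_mul_assoc,
      mul_smul_comm, mul_assoc, pow_two, mul_smul, smul_add, smul_sub]
    abel
  rw [h3, sub_nonneg] at h2
  have h4 := h2.trans (add_le_add_right h1 (c ^ 2 • (star x * x)))
  rw [← smul_add, pow_two, mul_smul] at h4
  exact le_of_smul_le_smul_left h4 hc

/-- A sum of positive elements is bounded by the largest row sum of a symmetric matrix `c` of bounds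
on their overlaps `‖√Pᵢ √Pⱼ‖`. It replaces the usual argument through families of orthogonal
permutations. The reason is that `S = ∑ Pᵢ` satisfies `S² = ∑ √Pᵢ (√Pᵢ √Pⱼ) √Pⱼ ≤ r S`. -/
theorem sum_le_of_overlap {ι : Type*} [Fintype ι] (P : ι → R) (hP : ∀ i, 0 ≤ P i)
    (c : ι → ι → ℝ) (hc : ∀ i j, 0 < c i j) (hsymm : ∀ i j, c i j = c j i)
    (hov : ∀ i j, ‖CFC.sqrt (P i) * CFC.sqrt (P j)‖ ≤ c i j)
    {r : ℝ} (hr : 0 ≤ r) (hrow : ∀ i, ∑ j, c i j ≤ r) :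
    ∑ i, P i ≤ r • (1 : R) := by
  set S := ∑ i, P i with hS
  have hS0 : 0 ≤ S := Finset.sum_nonneg fun i _ => hP i
  have hs : ∀ i, star (CFC.sqrt (P i)) = CFC.sqrt (P i) := fun i =>
    (IsSelfAdjoint.of_nonneg (CFC.sqrt_nonneg (P i))).star_eq
  have hq : ∀ i, CFC.sqrt (P i) * CFC.sqrt (P i) = P i := fun i =>
    CFC.sqrt_mul_sqrt_self _ (hP i)
  have hpair : ∀ i j, P i * P j + P j * P i ≤ c i j • (P i + P j) := by
    intro i j
    have h := star_mul_mul_add_le (hc i j) (hov i j) (CFC.sqrt (P i)) (CFC.sqrt (P j))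
    simp only [star_mul, hs, hq] at h
    convert h using 2 <;> (conv_lhs => rw [← hq i, ← hq j]) <;> simp only [mul_assoc]
  have hSS : S * S + S * S ≤ r • (S + S) := by
    have e1 : S * S + S * S = ∑ i, ∑ j, (P i * P j + P j * P i) := by
      simp only [Finset.sum_add_distrib]
      congr 1
      · rw [hS, Finset.sum_mul_sum]
      · rw [Finset.sum_comm, hS, Finset.sum_mul_sum]
    have e2 : ∑ i, ∑ j, c i j • (P i + P j) = (∑ i, (∑ j, c i j) • P i) +
        ∑ i, (∑ j, c i j) • P i := by
      simp only [smul_add, Finset.sum_add_distrib, Finset.sum_smul]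
      congr 1
      rw [Finset.sum_comm]
      exact Finset.sum_congr rfl fun i _ => Finset.sum_congr rfl fun j _ => by rw [hsymm]
    have e3 : ∑ i, (∑ j, c i j) • P i ≤ r • S := by
      rw [hS, Finset.smul_sum]
      exact Finset.sum_le_sum fun i _ => smul_le_smul_of_nonneg_right (hrow i) (hP i)
    rw [e1, smul_add]
    exact (Finset.sum_le_sum fun i _ => Finset.sum_le_sum fun j _ => hpair i j).trans
      (e2.le.trans (add_le_add e3 e3))
  have hSS' : S * S ≤ r • S := by
    rw [← two_smul ℝ, ← two_smul ℝ S, smul_comm r] at hSS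
    exact le_of_smul_le_smul_left hSS two_pos
  have hsa : IsSelfAdjoint S := IsSelfAdjoint.of_nonneg hS0
  have hn : ‖S‖ ≤ r := by
    have h1 : ‖S * S‖ ≤ ‖r • S‖ :=
      CStarAlgebra.norm_le_norm_of_nonneg_of_le hsa.mul_self_nonneg hSS'
    rw [hsa.norm_mul_self, norm_smul, Real.norm_of_nonneg hr, pow_two] at h1
    rcases (norm_nonneg S).eq_or_lt with h | h
    · rwa [← h]
    · exact le_of_mul_le_mul_right h1 h
  have := (CStarAlgebra.norm_le_iff_le_algebraMap S hr hS0).1 hn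
  rwa [Algebra.algebraMap_eq_smul_one] at this

theorem norm_sq_le_of_mul_star_le {x : R} {c : ℝ} (hc : 0 ≤ c) (h : x * star x ≤ c • (1 : R)) :
    ‖x‖ ^ 2 ≤ c := by
  rw [pow_two, ← CStarRing.norm_self_mul_star,
    CStarAlgebra.norm_le_iff_le_algebraMap _ hc (mul_star_self_nonneg x),
    Algebra.algebraMap_eq_smul_one]
  exact h

theorem star_mul_le_of_mul_star_le {x : R} {c : ℝ} (hc : 0 ≤ c) (h : x * star x ≤ c • (1 : R)) :
    star x * x ≤ c • (1 : R) := by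
  have h1 := CStarAlgebra.star_mul_le_algebraMap_norm_sq (a := x)
  rw [← Algebra.algebraMap_eq_smul_one]
  exact h1.trans (algebraMap_mono R (norm_sq_le_of_mul_star_le hc h))

theorem conjugate_le_of_conjugate_le {K X : R} {c : ℝ} (hc : 0 ≤ c) (hK : IsSelfAdjoint K)
    (hX : IsSelfAdjoint X) (hXX : X * X = X) (h : X * (K * K) * X ≤ c • (1 : R)) :
    K * X * K ≤ c • (1 : R) := by
  have h1 := star_mul_le_of_mul_star_le (x := X * K) hc (by
    rw [star_mul, hK.star_eq, hX.star_eq, mul_assoc, ← mul_assoc K, ← mul_assoc]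
    exact h)
  rwa [star_mul, hK.star_eq, hX.star_eq, mul_assoc, ← mul_assoc X, hXX, ← mul_assoc] at h1

/-- The overlap `‖√P √Q‖` is monotone in `P` and `Q`: it may be bounded through `P ≤ K²` and
`Q ≤ Q'`, where `K Q' K` is small. -/
theorem norm_sqrt_mul_sqrt_le {P Q K Q' : R} {c : ℝ} (hc : 0 ≤ c) (hP : 0 ≤ P) (hQ : 0 ≤ Q)
    (hK : IsSelfAdjoint K) (hPK : P ≤ K * K) (hQQ : Q ≤ Q') (h : K * Q' * K ≤ (c ^ 2) • (1 : R)) :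
    ‖CFC.sqrt P * CFC.sqrt Q‖ ≤ c := by
  have hQ' : 0 ≤ Q' := hQ.trans hQQ
  have sP : star (CFC.sqrt P) = CFC.sqrt P := (IsSelfAdjoint.of_nonneg (CFC.sqrt_nonneg P)).star_eq
  have sQ : star (CFC.sqrt Q) = CFC.sqrt Q := (IsSelfAdjoint.of_nonneg (CFC.sqrt_nonneg Q)).star_eq
  have sQ' : star (CFC.sqrt Q') = CFC.sqrt Q' :=
    (IsSelfAdjoint.of_nonneg (CFC.sqrt_nonneg Q')).star_eq
  have qP := CFC.sqrt_mul_sqrt_self P hP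
  have qQ := CFC.sqrt_mul_sqrt_self Q hQ
  have qQ' := CFC.sqrt_mul_sqrt_self Q' hQ'
  have hc2 : 0 ≤ c ^ 2 := sq_nonneg c
  have h1 : CFC.sqrt Q' * (K * K) * CFC.sqrt Q' ≤ c ^ 2 • (1 : R) := by
    have h2 := star_mul_le_of_mul_star_le (x := K * CFC.sqrt Q') hc2 (by
      rw [star_mul, hK.star_eq, sQ', mul_assoc, ← mul_assoc (CFC.sqrt Q'), qQ', ← mul_assoc]
      exact h)
    rw [star_mul, hK.star_eq, sQ'] at h2
    simpa only [mul_assoc] using h2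
  have h2 : CFC.sqrt Q' * P * CFC.sqrt Q' ≤ c ^ 2 • (1 : R) :=
    (conjugate_le_conjugate_of_nonneg hPK (CFC.sqrt_nonneg Q')).trans h1
  have h3 : CFC.sqrt P * Q' * CFC.sqrt P ≤ c ^ 2 • (1 : R) := by
    have h4 := star_mul_le_of_mul_star_le (x := CFC.sqrt Q' * CFC.sqrt P) hc2 (by
      rw [star_mul, sP, sQ', mul_assoc, ← mul_assoc (CFC.sqrt P), qP, ← mul_assoc]
      exact h2)
    rw [star_mul, sP, sQ', mul_assoc, ← mul_assoc (CFC.sqrt Q'), qQ', ← mul_assoc] at h4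
    exact h4
  have h5 := norm_sq_le_of_mul_star_le (x := CFC.sqrt P * CFC.sqrt Q) hc2 (by
    rw [star_mul, sP, sQ, mul_assoc, ← mul_assoc (CFC.sqrt Q), qQ, ← mul_assoc]
    exact (conjugate_le_conjugate_of_nonneg hQQ (CFC.sqrt_nonneg P)).trans h3)
  exact (sq_le_sq₀ (norm_nonneg _) hc).1 h5

end CStar
/-! ### A case of Maclaurin's inequality -/

section Combinatorics
open Polynomial

theorem coeff_mul_le_coeff_mul {p q p' q' : ℝ[X]} (hp : ∀ i, 0 ≤ p.coeff i)
    (hp' : ∀ i, p.coeff i ≤ p'.coeff i) (hq : ∀ i, 0 ≤ q.coeff i)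
    (hq' : ∀ i, q.coeff i ≤ q'.coeff i) (i : ℕ) : (p * q).coeff i ≤ (p' * q').coeff i := by
  rw [coeff_mul, coeff_mul]
  exact Finset.sum_le_sum fun x _ =>
    mul_le_mul (hp' _) (hq' _) (hq _) ((hp _).trans (hp' _))

theorem coeff_pow_le_coeff_pow {p q : ℝ[X]} (hp : ∀ i, 0 ≤ p.coeff i)
    (hpq : ∀ i, p.coeff i ≤ q.coeff i) (N i : ℕ) :
    0 ≤ (p ^ N).coeff i ∧ (p ^ N).coeff i ≤ (q ^ N).coeff i := by
  induction N generalizing i with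
  | zero => simp only [pow_zero, le_refl, and_true, coeff_one]; split_ifs <;> norm_num
  | succ N ih =>
    rw [pow_succ, pow_succ]
    refine ⟨?_, coeff_mul_le_coeff_mul (fun j => (ih j).1) (fun j => (ih j).2) hp hpq i⟩
    rw [coeff_mul]
    exact Finset.sum_nonneg fun x _ => mul_nonneg (ih _).1 (hp _)

/-- A case of Maclaurin's inequality: among `2k` numbers of which `k` are `1` and `k` are `x`, the
mean over the `k`-element subsets of the product is at most the `k`-th power of the mean. The two
sides are coefficients of `((1 + Y)(x + Y))ᵏ` and `(((1 + x)/2 + Y)²)ᵏ`, and the second base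
dominates the first coefficientwise. -/
theorem sum_powersetCard_prod_le {k : ℕ} (S : Finset (Fin (2 * k))) (hS : S.card = k) {x : ℝ}
    (hx : 0 ≤ x) :
    ∑ b ∈ Finset.powersetCard k (Finset.univ : Finset (Fin (2 * k))),
        ∏ i ∈ b, (if i ∈ S then 1 else x) ≤ (2 * k).choose k * ((1 + x) / 2) ^ k := by
  have hk : k ≤ (Finset.univ : Finset (Fin (2 * k))).card := by simp; omega
  have hkk : 2 * k - k = k := by omega
  have h1 := Finset.prod_X_add_C_coeff (Finset.univ : Finset (Fin (2 * k)))
    (fun i => if i ∈ S then (1 : ℝ) else x) hk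
  have h2 := Finset.prod_X_add_C_coeff (Finset.univ : Finset (Fin (2 * k)))
    (fun _ => (1 + x) / 2) hk
  have hc : (Finset.univ.filter fun i => i ∉ S).card = k := by
    rw [Finset.filter_not, Finset.filter_mem_eq_inter, Finset.univ_inter,
      ← Finset.compl_eq_univ_sdiff, Finset.card_compl, Fintype.card_fin]; omega
  rw [Finset.card_univ, Fintype.card_fin, hkk] at h1 h2
  rw [← h1]
  have h3 : ∏ i : Fin (2 * k), (X + C (if i ∈ S then (1 : ℝ) else x)) =
      ((X + C 1) * (X + C x)) ^ k := by
    have : ∀ i : Fin (2 * k), (X + C (if i ∈ S then (1 : ℝ) else x)) =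
        if i ∈ S then X + C 1 else X + C x := fun i => by split_ifs <;> rfl
    simp only [this, Finset.prod_ite, Finset.prod_const, hc, mul_pow]
    rw [Finset.filter_mem_eq_inter, Finset.univ_inter, hS]
  have h4 : ∏ i : Fin (2 * k), (X + C ((1 + x) / 2)) =
      ((X + C ((1 + x) / 2)) * (X + C ((1 + x) / 2))) ^ k := by
    rw [Finset.prod_const, Finset.card_univ, Fintype.card_fin, pow_mul, pow_two]
  have h5 : ∑ b ∈ Finset.powersetCard k (Finset.univ : Finset (Fin (2 * k))),
      ∏ i ∈ b, ((1 + x) / 2) = (2 * k).choose k * ((1 + x) / 2) ^ k := by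
    rw [Finset.sum_congr rfl fun b hb => by
      rw [Finset.prod_const, (Finset.mem_powersetCard.1 hb).2], Finset.sum_const,
      Finset.card_powersetCard, Finset.card_univ, Fintype.card_fin, nsmul_eq_mul]
  rw [← h5, ← h2, h3, h4]
  have e : ∀ u v : ℝ, (X + C u) * (X + C v) = X ^ 2 + C (u + v) * X + C (u * v) := fun u v => by
    simp only [C_add, C_mul]; ring
  have hcoef : ∀ (u v : ℝ) (i : ℕ), ((X + C u) * (X + C v)).coeff i =
      (if i = 2 then 1 else 0) + (if i = 1 then u + v else 0) + if i = 0 then u * v else 0 := by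
    intro u v i
    rw [e]
    simp only [coeff_add, coeff_X_pow, coeff_C_mul, coeff_X, coeff_C]
    congr 2
    simp [eq_comm]
  -- Only the constant coefficients differ, and `x ≤ ((1 + x) / 2)²`.
  refine (coeff_pow_le_coeff_pow ?_ ?_ k k).2 <;> intro i
  · rw [hcoef]; split_ifs <;> linarith
  · rw [hcoef, hcoef]
    have := sq_nonneg (1 - x)
    split_ifs <;> nlinarith

theorem cos_pi_div_eight_sq : Real.cos (Real.pi / 8) ^ 2 = (1 + √2 / 2) / 2 := by
  rw [Real.cos_sq, show 2 * (Real.pi / 8) = Real.pi / 4 by ring, Real.cos_pi_div_four]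
  ring

end Combinatorics

/-! ### Register subspaces as sets of positions -/

section RegisterSubspaces

theorem support_span {n : ℕ} (S : Finset (Fin n)) :
    support (Submodule.span (ZMod 2) ((fun i => (Pi.single i 1 : Bits n)) '' (S : Set (Fin n))))
      = S := by
  classical
  have hb : (fun i => (Pi.single i 1 : Bits n)) = Pi.basisFun (ZMod 2) (Fin n) := by
    funext i; simp
  ext i
  simp only [support, Finset.mem_filter, Finset.mem_univ, true_and]
  rw [hb, ← Pi.basisFun_apply]
  exact (Pi.basisFun (ZMod 2) (Fin n)).self_mem_span_image

theorem eq_span_support {n : ℕ} {a : Submodule (ZMod 2) (Bits n)} (ha : IsRegisterSubspace a) :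
    a = Submodule.span (ZMod 2)
      ((fun i => (Pi.single i 1 : Bits n)) '' (support a : Set (Fin n))) := by
  classical
  obtain ⟨S, rfl⟩ := ha
  conv_rhs => rw [← Set.coe_toFinset S, support_span]
  rw [Set.coe_toFinset]

/-- Register subspaces of dimension `k` correspond to `k`-element sets of positions. -/
def regSubEquiv (k : ℕ) :
    RegSub k ≃ Finset.powersetCard k (Finset.univ : Finset (Fin (2 * k))) where
  toFun a := ⟨support a.1, by simp [a.card_support]⟩
  invFun S := ⟨Submodule.span (ZMod 2) ((fun i => (Pi.single i 1 : Bits (2 * k))) ''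
    (S.1 : Set (Fin (2 * k)))), ⟨_, rfl⟩, by
      rw [← card_support ⟨_, rfl⟩, support_span]
      exact (Finset.mem_powersetCard.1 S.2).2⟩
  left_inv a := Subtype.ext (eq_span_support a.2.1).symm
  right_inv S := Subtype.ext (support_span S.1)

theorem card_regSub (k : ℕ) : Fintype.card (RegSub k) = (2 * k).choose k := by
  rw [Fintype.card_congr (regSubEquiv k), Fintype.card_coe, Finset.card_powersetCard,
    Finset.card_univ, Fintype.card_fin]

/-- The number of positions that lie in `b` but not in `a`. -/
def defect {k : ℕ} (a b : RegSub k) : ℕ := (support b.1 \ support a.1).card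

theorem defect_comm {k : ℕ} (a b : RegSub k) : defect a b = defect b a :=
  Finset.card_sdiff_comm (b.card_support.trans a.card_support.symm)

theorem card_inter_add_defect {k : ℕ} (a b : RegSub k) :
    (support b.1 ∩ support a.1).card + defect a b = k := by
  rw [defect, Finset.card_inter_add_card_sdiff, b.card_support]

theorem sum_pow_defect_le {k : ℕ} (a : RegSub k) {x : ℝ} (hx : 0 ≤ x) :
    ∑ b : RegSub k, x ^ defect a b ≤ Fintype.card (RegSub k) * ((1 + x) / 2) ^ k := by
  have h := sum_powersetCard_prod_le (support a.1) a.card_support hx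
  rw [card_regSub]
  refine le_trans (le_of_eq ?_) h
  rw [← Finset.sum_coe_sort (Finset.powersetCard k Finset.univ)
    (fun b => ∏ i ∈ b, if i ∈ support a.1 then (1 : ℝ) else x), ← (regSubEquiv k).sum_comp]
  refine Finset.sum_congr rfl fun b _ => ?_
  rw [show ((regSubEquiv k b).1 : Finset _) = support b.1 from rfl, Finset.prod_ite,
    Finset.prod_const_one, one_mul, Finset.prod_const, defect, Finset.sdiff_eq_filter]

theorem mem_iff_forall_notMem_support {k : ℕ} (a : RegSub k) (v : Bits (2 * k)) :
    v ∈ a.1 ↔ ∀ i, i ∉ support a.1 → v i = 0 := by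
  classical
  constructor
  · intro hv i hi
    rw [eq_span_support a.2.1] at hv
    induction hv using Submodule.span_induction with
    | mem x hx =>
      obtain ⟨j, hj, rfl⟩ := hx
      have hij : i ≠ j := fun h => hi (by rw [h]; exact hj)
      exact Pi.single_eq_of_ne hij _
    | zero => rfl
    | add x y _ _ hx hy => simp [hx, hy]
    | smul c x _ hx => simp [hx]
  · intro h
    rw [← Finset.univ_sum_single v]
    refine Submodule.sum_mem _ fun i _ => ?_
    by_cases hi : i ∈ support a.1
    · have : (Pi.single i (v i) : Bits (2 * k)) = v i • Pi.single i 1 := by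
        rw [← Pi.single_smul, smul_eq_mul, mul_one]
      rw [this]
      exact Submodule.smul_mem _ _ (by simpa [support] using hi)
    · rw [h i hi, Pi.single_zero]; exact Submodule.zero_mem _

theorem natCard_regSub_coe {k : ℕ} (a : RegSub k) : Nat.card a.1 = 2 ^ k := by
  rw [Module.natCard_eq_pow_finrank (K := ZMod 2), a.2.2, Nat.card_zmod]

end RegisterSubspaces

/-! ### Coset states and the projections they span -/

section CosetStates

/-- The restriction of a bit string to the positions of `a`. -/
def innerBits {k : ℕ} (a : RegSub k) (v : Bits (2 * k)) : Bits k :=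
  fun j => v ((support a.1).orderEmbOfFin a.card_support j)

/-- The restriction of a bit string to the positions outside `a`. -/
def outerBits {k : ℕ} (a : RegSub k) (v : Bits (2 * k)) : Bits k :=
  fun j => v ((support a.1)ᶜ.orderEmbOfFin a.card_support_compl j)

/-- The sign `(-1) ^ z` of a bit. -/
def bitSign : AddChar (ZMod 2) ℂ where
  toFun z := (-1) ^ z.val
  map_zero_eq_one' := by simp
  map_add_eq_mul' x y := by
    have h : ∀ x y : ZMod 2, (-1 : ℤ) ^ (x + y).val = (-1) ^ x.val * (-1) ^ y.val := by decide
    exact_mod_cast congrArg (Int.cast : ℤ → ℂ) (h x y)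

theorem bitSign_apply (z : ZMod 2) : bitSign z = (-1) ^ z.val := rfl

theorem star_bitSign (z : ZMod 2) : star (bitSign z) = bitSign z := by
  simp [bitSign_apply]

theorem sum_bitSign_dotProduct {k : ℕ} (w : Bits k) :
    ∑ t : Bits k, bitSign (w ⬝ᵥ t) = if w = 0 then 2 ^ k else 0 := by
  have h1 : ∀ t : Bits k, bitSign (w ⬝ᵥ t) = ∏ j, bitSign (w j * t j) := fun t => by
    
    have h : ∀ u : Finset (Fin k), bitSign (∑ j ∈ u, w j * t j) = ∏ j ∈ u, bitSign (w j * t j) := by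
      intro u
      induction u using Finset.induction_on with
      | empty => simp
      | insert j u hj ih =>
        rw [Finset.sum_insert hj, Finset.prod_insert hj, AddChar.map_add_eq_mul, ih]
    exact h _
  have h2 : ∀ z : ZMod 2, ∑ y : ZMod 2, bitSign (z * y) = if z = 0 then 2 else 0 := by
    intro z
    have h : ∀ z : ZMod 2, ∑ y : ZMod 2, (-1 : ℤ) ^ (z * y).val = if z = 0 then 2 else 0 := by
      decide
    simp only [bitSign_apply]
    exact_mod_cast congrArg (Int.cast : ℤ → ℂ) (h z)
  simp only [h1]
  rw [← Fintype.piFinset_univ, ← Finset.prod_univ_sum (fun _ => Finset.univ)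
    (fun j y => bitSign (w j * y))]
  simp only [h2]
  split_ifs with hw
  · simp [hw]
  · obtain ⟨j, hj⟩ := Function.ne_iff.1 hw
    exact Finset.prod_eq_zero (Finset.mem_univ j) (if_neg hj)

theorem place_apply_mem {n k : ℕ} (S : Finset (Fin n)) (h : S.card = k) (t : Bits k) (j : Fin k) :
    place S h t (S.orderEmbOfFin h j) = t j := by
  simp [place, Finset.sum_apply, Pi.single_apply]

theorem place_apply_notMem {n k : ℕ} (S : Finset (Fin n)) (h : S.card = k) (t : Bits k) {i : Fin n}
    (hi : i ∉ S) : place S h t i = 0 := by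
  rw [place, Finset.sum_apply]
  refine Finset.sum_eq_zero fun j _ => Pi.single_eq_of_ne ?_ _
  rintro rfl
  exact hi (S.orderEmbOfFin_mem h j)

theorem dotProduct_place {n k : ℕ} (S : Finset (Fin n)) (h : S.card = k) (t : Bits k) (v : Bits n) :
    v ⬝ᵥ place S h t = (fun j => v (S.orderEmbOfFin h j)) ⬝ᵥ t := by
  rw [place, dotProduct_sum, dotProduct]
  simp only [dotProduct_single]

theorem exists_orderEmbOfFin_eq {n k : ℕ} {S : Finset (Fin n)} (h : S.card = k) {i : Fin n}
    (hi : i ∈ S) : ∃ j, S.orderEmbOfFin h j = i := by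
  have : i ∈ Set.range (S.orderEmbOfFin h) := by rw [Finset.range_orderEmbOfFin]; exact hi
  exact this

theorem sub_place_mem_iff {k : ℕ} (a : RegSub k) (t : Bits k) (v : Bits (2 * k)) :
    v - place (support a.1)ᶜ a.card_support_compl t ∈ a.1 ↔ outerBits a v = t := by
  rw [mem_iff_forall_notMem_support]
  constructor
  · intro h
    funext j
    have h1 := h _ (Finset.mem_compl.1 ((support a.1)ᶜ.orderEmbOfFin_mem a.card_support_compl j))
    rw [Pi.sub_apply, place_apply_mem, sub_eq_zero] at h1
    exact h1
  · rintro rfl i hi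
    obtain ⟨j, rfl⟩ := exists_orderEmbOfFin_eq a.card_support_compl (Finset.mem_compl.2 hi)
    rw [Pi.sub_apply, place_apply_mem, sub_eq_zero]
    rfl

theorem cosetState_apply {k : ℕ} (a : RegSub k) (t t' : Bits k) (v : Bits (2 * k)) :
    cosetState a t t' v =
      if outerBits a v = t then ((1 / √(2 ^ k) : ℝ) : ℂ) * bitSign (innerBits a v ⬝ᵥ t') else 0 := by
  classical
  rw [cosetState, cosetVec, Pi.smul_apply, Finset.sum_apply, natCard_regSub_coe, smul_eq_mul]
  set p := place (support a.1)ᶜ a.card_support_compl t with hp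
  rw [Finset.sum_eq_single (v - p)]
  · rw [sub_place_mem_iff]
    split_ifs with h
    · rw [sub_add_cancel, Pi.smul_apply, Pi.single_eq_same, smul_eq_mul, mul_one, dotProduct_place,
        bitSign_apply]
      have : (fun j => (v - p) ((support a.1).orderEmbOfFin a.card_support j)) = innerBits a v := by
        funext j
        rw [Pi.sub_apply, hp, place_apply_notMem _ _ _ (by
          rw [Finset.mem_compl, not_not]; exact Finset.orderEmbOfFin_mem _ _ _), sub_zero]
        rfl
      rw [this]
      push_cast
      rfl
    · simp
  · intro u _ hu
    split_ifs
    · rw [Pi.smul_apply, Pi.single_eq_of_ne, smul_zero]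
      rintro rfl
      exact hu (by simp)
    · rfl
  · simp

theorem ext_outerBits_innerBits {k : ℕ} (a : RegSub k) {v w : Bits (2 * k)}
    (ho : outerBits a v = outerBits a w) (hi : innerBits a v = innerBits a w) : v = w := by
  funext i
  by_cases h : i ∈ support a.1
  · obtain ⟨j, rfl⟩ := exists_orderEmbOfFin_eq a.card_support h
    exact congrFun hi j
  · obtain ⟨j, rfl⟩ := exists_orderEmbOfFin_eq a.card_support_compl (Finset.mem_compl.2 h)
    exact congrFun ho j

theorem ketbra_cosetState_apply {k : ℕ} (a : RegSub k) (s s' : Bits k) (v w : Bits (2 * k)) :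
    ketbra (cosetState a s s') v w = if outerBits a v = s ∧ outerBits a w = s then
      (2 ^ k)⁻¹ * bitSign ((innerBits a v + innerBits a w) ⬝ᵥ s') else 0 := by
  have h2 : ((1 / √(2 ^ k) : ℝ) : ℂ) * ((1 / √(2 ^ k) : ℝ) : ℂ) = (2 ^ k)⁻¹ := by
    rw [← Complex.ofReal_mul, div_mul_div_comm, one_mul, Real.mul_self_sqrt (by positivity)]
    push_cast
    rw [one_div]
  rw [ketbra, Matrix.vecMulVec_apply, Pi.star_apply, cosetState_apply, cosetState_apply]
  by_cases h : outerBits a v = s <;> by_cases h' : outerBits a w = s <;> simp only [h, h', if_true,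
    if_false, and_true, and_false, star_zero, mul_zero, zero_mul]
  rw [star_mul', star_bitSign, add_dotProduct, AddChar.map_add_eq_mul, ← h2]
  simp only [RCLike.star_def, Complex.conj_ofReal]
  ring

/-- The projection onto the bit strings whose value outside `a` is `s`. -/
def outerProj {k : ℕ} (a : RegSub k) (s : Bits k) : Matrix (Bits (2 * k)) (Bits (2 * k)) ℂ :=
  Matrix.diagonal fun v => if outerBits a v = s then 1 else 0

/-- The projection onto the span of the coset states of `a` with phase string `s'`. -/
def phaseProj {k : ℕ} (a : RegSub k) (s' : Bits k) : Matrix (Bits (2 * k)) (Bits (2 * k)) ℂ :=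
  ∑ s, ketbra (cosetState a s s')

theorem posSemidef_ketbra {X : Type*} [Fintype X] (v : X → ℂ) : (ketbra v).PosSemidef :=
  Matrix.posSemidef_vecMulVec_self_star v

theorem sum_ketbra_cosetState {k : ℕ} (a : RegSub k) (s : Bits k) :
    ∑ s', ketbra (cosetState a s s') = outerProj a s := by
  ext v w
  rw [Matrix.sum_apply, outerProj, Matrix.diagonal_apply]
  simp only [ketbra_cosetState_apply]
  by_cases h : outerBits a v = s ∧ outerBits a w = s
  · simp only [h, and_self, if_true]
    rw [← Finset.mul_sum, sum_bitSign_dotProduct]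
    have : innerBits a v + innerBits a w = 0 ↔ v = w := by
      rw [add_eq_zero_iff_eq_neg, ZModModule.neg_eq_self]
      exact ⟨ext_outerBits_innerBits a (h.1.trans h.2.symm), fun h => h ▸ rfl⟩
    simp only [this]
    split_ifs <;> simp
  · simp only [if_neg h, Finset.sum_const_zero]
    split_ifs with h1 h2
    · subst h1; exact absurd ⟨h2, h2⟩ h
    · rfl
    · rfl

theorem sum_outerProj {k : ℕ} (a : RegSub k) : ∑ s, outerProj a s = 1 := by
  ext v w
  simp only [Matrix.sum_apply, outerProj, Matrix.diagonal_apply, Matrix.one_apply]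
  split_ifs <;> simp

theorem outerProj_posSemidef {k : ℕ} (a : RegSub k) (s : Bits k) : (outerProj a s).PosSemidef := by
  rw [outerProj, Matrix.posSemidef_diagonal_iff]
  intro v
  split_ifs <;> simp

theorem outerProj_commute {k : ℕ} (a b : RegSub k) (s t : Bits k) :
    Commute (outerProj a s) (outerProj b t) := by
  rw [Commute, SemiconjBy, outerProj, outerProj, Matrix.diagonal_mul_diagonal,
    Matrix.diagonal_mul_diagonal]
  simp only [mul_comm]

theorem outerProj_mul_outerProj {k : ℕ} (a : RegSub k) (s t : Bits k) :
    outerProj a s * outerProj a t = if s = t then outerProj a s else 0 := by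
  rw [outerProj, outerProj, Matrix.diagonal_mul_diagonal]
  split_ifs with h
  · subst h; congr 1; funext v; split_ifs <;> simp
  · rw [← Matrix.diagonal_zero]; congr 1; funext v; split_ifs with h1 h2
    · exact absurd (h1.symm.trans h2) h
    all_goals simp

theorem outerProj_mul_ketbra {k : ℕ} (a : RegSub k) (r s s' : Bits k) :
    outerProj a r * ketbra (cosetState a s s') =
      if s = r then ketbra (cosetState a s s') else 0 := by
  ext v w
  rw [outerProj, Matrix.diagonal_mul]
  split_ifs with h1 h2 h2
  · rw [one_mul]
  · rw [ketbra_cosetState_apply, if_neg (fun h => h2 (h.1.symm.trans h1)), mul_zero]; rfl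
  · rw [ketbra_cosetState_apply, if_neg (fun h => h1 (h.1.trans h2)), mul_zero]
  · rw [zero_mul]; rfl

theorem outerProj_mul_phaseProj {k : ℕ} (a : RegSub k) (s s' : Bits k) :
    outerProj a s * phaseProj a s' = ketbra (cosetState a s s') := by
  rw [phaseProj, Finset.mul_sum]
  simp only [outerProj_mul_ketbra]
  simp

theorem phaseProj_posSemidef {k : ℕ} (a : RegSub k) (s' : Bits k) :
    (phaseProj a s').PosSemidef :=
  Matrix.posSemidef_sum _ fun _ _ => posSemidef_ketbra _

theorem phaseProj_mul_outerProj {k : ℕ} (a : RegSub k) (s s' : Bits k) :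
    phaseProj a s' * outerProj a s = ketbra (cosetState a s s') := by
  have h := congrArg Matrix.conjTranspose (outerProj_mul_phaseProj a s s')
  rwa [Matrix.conjTranspose_mul, (phaseProj_posSemidef a s').isHermitian.eq,
    (outerProj_posSemidef a s).isHermitian.eq, (posSemidef_ketbra _).isHermitian.eq] at h

theorem sum_phaseProj {k : ℕ} (a : RegSub k) : ∑ s', phaseProj a s' = 1 := by
  simp only [phaseProj]
  rw [Finset.sum_comm, ← sum_outerProj a]
  exact Finset.sum_congr rfl fun s _ => sum_ketbra_cosetState a s

theorem phaseProj_le_one {k : ℕ} (a : RegSub k) (s' : Bits k) : phaseProj a s' ≤ 1 := by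
  rw [← sum_phaseProj a]
  exact Finset.single_le_sum (f := phaseProj a)
    (fun t _ => Matrix.nonneg_iff_posSemidef.2 (phaseProj_posSemidef a t)) (Finset.mem_univ s')

theorem star_cosetState_dotProduct {k : ℕ} (a : RegSub k) (s r s' : Bits k)
    (f : Bits (2 * k) → ℂ) :
    star (cosetState a s s') ⬝ᵥ (Matrix.diagonal f).mulVec (cosetState a r s') =
      if s = r then (2 ^ k)⁻¹ * ∑ v, (if outerBits a v = s then f v else 0) else 0 := by
  have h : ∀ v, star (cosetState a s s' v) * (f v * cosetState a r s' v) =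
      if s = r then (2 ^ k)⁻¹ * (if outerBits a v = s then f v else 0) else 0 := by
    intro v
    split_ifs with h1 h2
    · subst h1
      have h3 := ketbra_cosetState_apply a s s' v v
      rw [if_pos ⟨h2, h2⟩, ZModModule.add_self, zero_dotProduct, AddChar.map_zero_eq_one,
        mul_one, ketbra, Matrix.vecMulVec_apply, Pi.star_apply] at h3
      rw [← h3]; ring
    · rw [cosetState_apply, if_neg h2]; simp
    · rw [cosetState_apply, cosetState_apply]
      split_ifs with h3 h4
      · exact absurd (h3.symm.trans h4) h1
      all_goals simp
  rw [dotProduct]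
  simp only [Matrix.mulVec_diagonal, Pi.star_apply, h]
  split_ifs
  · rw [Finset.mul_sum]
  · simp

theorem phaseProj_mul_diagonal_mul_phaseProj {k : ℕ} (a : RegSub k) (s' : Bits k)
    (f : Bits (2 * k) → ℂ) :
    phaseProj a s' * Matrix.diagonal f * phaseProj a s' =
      ∑ s, ((2 ^ k)⁻¹ * ∑ v, (if outerBits a v = s then f v else 0)) •
        ketbra (cosetState a s s') := by
  have h : ∀ s r, ketbra (cosetState a s s') * Matrix.diagonal f * ketbra (cosetState a r s') =
      if s = r then ((2 ^ k)⁻¹ * ∑ v, (if outerBits a v = s then f v else 0)) •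
        ketbra (cosetState a s s') else 0 := by
    intro s r
    rw [mul_assoc, ketbra, ketbra, Matrix.mul_vecMulVec, Matrix.vecMulVec_mul_vecMulVec,
      star_cosetState_dotProduct]
    split_ifs with h
    · subst h; exact Matrix.vecMulVec_smul _ _ _
    · rw [zero_smul, Matrix.vecMulVec_zero]
  conv_lhs => rw [phaseProj, Finset.sum_mul, Finset.sum_mul_sum]
  simp only [h, Finset.sum_ite_eq, Finset.mem_univ, if_true]

theorem card_outerBits_eq {k : ℕ} (a : RegSub k) (s : Bits k) :
    (Finset.univ.filter fun v => outerBits a v = s).card = 2 ^ k := by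
  have h : (Finset.univ : Finset (Bits k)).card = 2 ^ k := by
    rw [Finset.card_univ, Fintype.card_fun, ZMod.card, Fintype.card_fin]
  rw [← h]
  have hin : ∀ t', innerBits a (place (support a.1)ᶜ a.card_support_compl s +
      place (support a.1) a.card_support t') = t' := by
    intro t'
    funext j
    rw [innerBits, Pi.add_apply, place_apply_mem, place_apply_notMem _ _ _ (by
      rw [Finset.mem_compl, not_not]; exact Finset.orderEmbOfFin_mem _ _ _), zero_add]
  have hout : ∀ t', outerBits a (place (support a.1)ᶜ a.card_support_compl s +
      place (support a.1) a.card_support t') = s := by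
    intro t'
    funext j
    rw [outerBits, Pi.add_apply, place_apply_mem, place_apply_notMem (support a.1) _ _
      (Finset.mem_compl.1 (Finset.orderEmbOfFin_mem _ _ _)), add_zero]
  refine Finset.card_nbij' (innerBits a) (fun t' => place (support a.1)ᶜ a.card_support_compl s +
      place (support a.1) a.card_support t') ?_ ?_ ?_ ?_
  · intro v _; simp
  · intro t' _; simp [hout]
  · intro v hv
    simp only [Finset.coe_filter, Finset.mem_univ, true_and, Set.mem_ofPred_eq] at hv
    exact ext_outerBits_innerBits a ((hout _).trans hv.symm) (hin _)
  · intro t' _; exact hin t'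

theorem phaseProj_mul_self {k : ℕ} (a : RegSub k) (s' : Bits k) :
    phaseProj a s' * phaseProj a s' = phaseProj a s' := by
  have h := phaseProj_mul_diagonal_mul_phaseProj a s' (fun _ => 1)
  rw [Matrix.diagonal_one, mul_one] at h
  rw [h]
  conv_rhs => rw [phaseProj]
  refine Finset.sum_congr rfl fun s _ => ?_
  rw [Finset.sum_boole, card_outerBits_eq]
  push_cast
  rw [inv_mul_cancel₀ (by positivity), one_smul]

/-- A bit string with prescribed values outside `a` and outside `b` is determined by its values on
the positions that `a` and `b` share. -/
theorem card_outerBits_eq_le {k : ℕ} (a b : RegSub k) (s t : Bits k) :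
    (Finset.univ.filter fun v => outerBits b v = s ∧ outerBits a v = t).card ≤
      2 ^ (support b.1 ∩ support a.1).card := by
  have h := Finset.card_le_card_of_injOn (s := Finset.univ.filter fun v =>
    outerBits b v = s ∧ outerBits a v = t)
    (t := (Finset.univ : Finset ((support b.1 ∩ support a.1 : Finset _) → ZMod 2)))
    (fun v i => v i) (fun _ _ => Finset.mem_coe.2 (Finset.mem_univ _)) ?_
  · rwa [Finset.card_univ, Fintype.card_fun, ZMod.card, Fintype.card_coe] at h
  · intro v hv w hw hvw
    simp only [Finset.coe_filter, Finset.mem_univ, true_and, Set.mem_ofPred_eq] at hv hw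
    refine ext_outerBits_innerBits b (hv.1.trans hw.1.symm) (funext fun j => ?_)
    set i := (support b.1).orderEmbOfFin b.card_support j with hi
    change v i = w i
    by_cases h : i ∈ support a.1
    · exact congrFun hvw ⟨i, Finset.mem_inter.2 ⟨Finset.orderEmbOfFin_mem _ _ _, h⟩⟩
    · obtain ⟨j', hj'⟩ := exists_orderEmbOfFin_eq a.card_support_compl (Finset.mem_compl.2 h)
      rw [← hj']
      exact congrFun (hv.2.trans hw.2.symm) j'

/-- The uncertainty relation between the value outside `a` and the phases on `b`. -/
theorem phaseProj_mul_outerProj_mul_phaseProj_le {k : ℕ} (a b : RegSub k) (t s' : Bits k) :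
    phaseProj b s' * outerProj a t * phaseProj b s' ≤ ((√2 / 2) ^ defect a b) ^ 2 •
      (1 : Matrix (Bits (2 * k)) (Bits (2 * k)) ℂ) := by
  have hc : ((√2 / 2) ^ defect a b) ^ 2 = (2 ^ k : ℝ)⁻¹ * 2 ^ (support b.1 ∩ support a.1).card := by
    have h : (2 : ℝ) ^ k = 2 ^ (support b.1 ∩ support a.1).card * 2 ^ defect a b := by
      rw [← pow_add, card_inter_add_defect]
    rw [h, ← pow_mul, mul_comm, pow_mul, div_pow, Real.sq_sqrt zero_le_two,
      show (2 / 2 ^ 2 : ℝ) = 2⁻¹ by norm_num, inv_pow]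
    field_simp
  rw [outerProj, phaseProj_mul_diagonal_mul_phaseProj]
  refine le_trans ?_ (smul_le_smul_of_nonneg_left (phaseProj_le_one b s') (by positivity))
  rw [phaseProj, Finset.smul_sum]
  refine Finset.sum_le_sum fun s _ => ?_
  have : ((2 ^ k)⁻¹ * ∑ v, (if outerBits b v = s then
      (if outerBits a v = t then (1 : ℂ) else 0) else 0)) =
      (((2 ^ k : ℝ)⁻¹ *
        (Finset.univ.filter fun v => outerBits b v = s ∧ outerBits a v = t).card : ℝ) : ℂ) := by
    simp only [← ite_and]
    rw [Finset.sum_boole]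
    push_cast
    rfl
  rw [this, Complex.coe_smul]
  refine smul_le_smul_of_nonneg_right ?_ (Matrix.nonneg_iff_posSemidef.2 (posSemidef_ketbra _))
  rw [hc]
  gcongr
  exact_mod_cast card_outerBits_eq_le a b s t

end CosetStates

/-! ### The order on tensor products -/

section Kronecker

variable {X Y ι : Type*}

theorem kronecker_sum (s : Finset ι) (P : Matrix X X ℂ) (Q : ι → Matrix Y Y ℂ) :
    P ⊗ₖ (∑ i ∈ s, Q i) = ∑ i ∈ s, P ⊗ₖ Q i := by
  ext i j; simp only [Matrix.kroneckerMap_apply, Matrix.sum_apply, Finset.mul_sum]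

theorem sum_kronecker (s : Finset ι) (P : ι → Matrix X X ℂ) (Q : Matrix Y Y ℂ) :
    (∑ i ∈ s, P i) ⊗ₖ Q = ∑ i ∈ s, P i ⊗ₖ Q := by
  ext i j; simp only [Matrix.kroneckerMap_apply, Matrix.sum_apply, Finset.sum_mul]

theorem kronecker_sub (P : Matrix X X ℂ) (Q R : Matrix Y Y ℂ) :
    P ⊗ₖ (Q - R) = P ⊗ₖ Q - P ⊗ₖ R := by
  ext i j; simp only [Matrix.kroneckerMap_apply, Matrix.sub_apply, mul_sub]

theorem sub_kronecker (P Q : Matrix X X ℂ) (R : Matrix Y Y ℂ) :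
    (P - Q) ⊗ₖ R = P ⊗ₖ R - Q ⊗ₖ R := by
  ext i j; simp only [Matrix.kroneckerMap_apply, Matrix.sub_apply, sub_mul]

variable [Finite X] [Finite Y]

theorem kronecker_le_kronecker_left {P : Matrix X X ℂ} {Q R : Matrix Y Y ℂ} (hP : 0 ≤ P)
    (h : Q ≤ R) : P ⊗ₖ Q ≤ P ⊗ₖ R := by
  rw [Matrix.le_iff, ← kronecker_sub]
  exact (Matrix.nonneg_iff_posSemidef.1 hP).kronecker h

theorem kronecker_le_kronecker_right {P Q : Matrix X X ℂ} {R : Matrix Y Y ℂ} (hR : 0 ≤ R)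
    (h : P ≤ Q) : P ⊗ₖ R ≤ Q ⊗ₖ R := by
  rw [Matrix.le_iff, ← sub_kronecker]
  exact Matrix.PosSemidef.kronecker h (Matrix.nonneg_iff_posSemidef.1 hR)

theorem kronecker_nonneg {P : Matrix X X ℂ} {Q : Matrix Y Y ℂ} (hP : 0 ≤ P) (hQ : 0 ≤ Q) :
    0 ≤ P ⊗ₖ Q :=
  Matrix.nonneg_iff_posSemidef.2
    ((Matrix.nonneg_iff_posSemidef.1 hP).kronecker (Matrix.nonneg_iff_posSemidef.1 hQ))

end Kronecker

theorem IsPOVM.nonneg {S X : Type*} [Fintype S] [Fintype X] [DecidableEq X]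
    {P : S → Matrix X X ℂ} (hP : IsPOVM P) (s : S) : 0 ≤ P s :=
  Matrix.nonneg_iff_posSemidef.2 (hP.posSemidef s)

theorem IsPOVM.le_one {S X : Type*} [Fintype S] [Fintype X] [DecidableEq X]
    {P : S → Matrix X X ℂ} (hP : IsPOVM P) (s : S) : P s ≤ 1 := by
  rw [← hP.sum_eq_one]
  exact Finset.single_le_sum (fun s _ => hP.nonneg s) (Finset.mem_univ s)

/-! ### The operator bound for the game -/

section Overlap

variable {k : ℕ} {B C : Type*} [Fintype B] [DecidableEq B] [Fintype C] [DecidableEq C]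

/-- The event that Bob's outcome is `t` and Charlie's outcome is `t'`, when the coset state
`|a_{t,t'}⟩` is found on the first register. Charlie's measurement may depend on `t`. -/
def winOp (M : Bits k → Matrix B B ℂ) (N : Bits k → Bits k → Matrix C C ℂ) (a : RegSub k) :
    Matrix (Bits (2 * k) × B × C) (Bits (2 * k) × B × C) ℂ :=
  ∑ t, ∑ t', ketbra (cosetState a t t') ⊗ₖ (M t ⊗ₖ N t t')

/-- The event that Bob's outcome is the value found outside `a`. -/
def bobOp (M : Bits k → Matrix B B ℂ) (C : Type*) [DecidableEq C] (a : RegSub k) :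
    Matrix (Bits (2 * k) × B × C) (Bits (2 * k) × B × C) ℂ :=
  ∑ t, outerProj a t ⊗ₖ (M t ⊗ₖ (1 : Matrix C C ℂ))

/-- The event that Charlie, who is told the value found outside `a`, guesses the phases on `a`. -/
def charlieOp (B : Type*) [DecidableEq B] (N : Bits k → Bits k → Matrix C C ℂ) (a : RegSub k) :
    Matrix (Bits (2 * k) × B × C) (Bits (2 * k) × B × C) ℂ :=
  ∑ t, ∑ t', ketbra (cosetState a t t') ⊗ₖ ((1 : Matrix B B ℂ) ⊗ₖ N t t')

theorem ketbra_nonneg {X : Type*} [Fintype X] (v : X → ℂ) : 0 ≤ ketbra v :=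
  Matrix.nonneg_iff_posSemidef.2 (posSemidef_ketbra v)

theorem outerProj_nonneg (a : RegSub k) (s : Bits k) : 0 ≤ outerProj a s :=
  Matrix.nonneg_iff_posSemidef.2 (outerProj_posSemidef a s)

theorem winOp_nonneg {M : Bits k → Matrix B B ℂ} {N : Bits k → Bits k → Matrix C C ℂ}
    (hM : IsPOVM M) (hN : ∀ t, IsPOVM (N t)) (a : RegSub k) : 0 ≤ winOp M N a :=
  Finset.sum_nonneg fun t _ => Finset.sum_nonneg fun t' _ =>
    kronecker_nonneg (ketbra_nonneg _) (kronecker_nonneg (hM.nonneg t) ((hN t).nonneg t'))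

theorem winOp_le_bobOp {M : Bits k → Matrix B B ℂ} {N : Bits k → Bits k → Matrix C C ℂ}
    (hM : IsPOVM M) (hN : ∀ t, IsPOVM (N t)) (a : RegSub k) : winOp M N a ≤ bobOp M C a := by
  refine Finset.sum_le_sum fun t _ => ?_
  rw [← sum_ketbra_cosetState, sum_kronecker]
  exact Finset.sum_le_sum fun t' _ => kronecker_le_kronecker_left (ketbra_nonneg _)
    (kronecker_le_kronecker_left (hM.nonneg t) ((hN t).le_one t'))

theorem winOp_le_charlieOp {M : Bits k → Matrix B B ℂ} {N : Bits k → Bits k → Matrix C C ℂ}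
    (hM : IsPOVM M) (hN : ∀ t, IsPOVM (N t)) (a : RegSub k) :
    winOp M N a ≤ charlieOp B N a :=
  Finset.sum_le_sum fun t _ => Finset.sum_le_sum fun t' _ =>
    kronecker_le_kronecker_left (ketbra_nonneg _)
      (kronecker_le_kronecker_right ((hN t).nonneg t') (hM.le_one t))

omit [DecidableEq B] in
theorem bobOp_mul_bobOp (M M' : Bits k → Matrix B B ℂ) (a : RegSub k) :
    bobOp M C a * bobOp M' C a = bobOp (fun t => M t * M' t) C a := by
  simp only [bobOp]
  rw [Finset.sum_mul_sum]
  refine Finset.sum_congr rfl fun t _ => ?_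
  rw [Finset.sum_eq_single t]
  · rw [← Matrix.mul_kronecker_mul, outerProj_mul_outerProj, if_pos rfl,
      ← Matrix.mul_kronecker_mul, mul_one]
  · intro s _ hs
    rw [← Matrix.mul_kronecker_mul, outerProj_mul_outerProj, if_neg hs.symm,
      Matrix.zero_kronecker]
  · simp

/-- Charlie's outcome operators for the phase string `s'`, as a block operator over the value
found outside `a`. -/
def charlieBlock (B : Type*) [DecidableEq B] (N : Bits k → Bits k → Matrix C C ℂ) (a : RegSub k)
    (s' : Bits k) : Matrix (Bits (2 * k) × B × C) (Bits (2 * k) × B × C) ℂ :=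
  ∑ s, outerProj a s ⊗ₖ ((1 : Matrix B B ℂ) ⊗ₖ N s s')

omit [DecidableEq C] in
theorem charlieBlock_mul_charlieBlock (N N' : Bits k → Bits k → Matrix C C ℂ) (a : RegSub k)
    (s' : Bits k) : charlieBlock B N a s' * charlieBlock B N' a s' =
      charlieBlock B (fun s s' => N s s' * N' s s') a s' := by
  simp only [charlieBlock]
  rw [Finset.sum_mul_sum]
  refine Finset.sum_congr rfl fun t _ => ?_
  rw [Finset.sum_eq_single t]
  · rw [← Matrix.mul_kronecker_mul, outerProj_mul_outerProj, if_pos rfl,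
      ← Matrix.mul_kronecker_mul, mul_one]
  · intro s _ hs
    rw [← Matrix.mul_kronecker_mul, outerProj_mul_outerProj, if_neg hs.symm,
      Matrix.zero_kronecker]
  · simp

theorem commute_bobOp_charlieBlock (M : Bits k → Matrix B B ℂ)
    (N : Bits k → Bits k → Matrix C C ℂ) (a b : RegSub k) (s' : Bits k) :
    Commute (bobOp M C a) (charlieBlock B N b s') := by
  refine Commute.sum_left _ _ _ fun t _ => Commute.sum_right _ _ _ fun s _ => ?_
  rw [Commute, SemiconjBy, ← Matrix.mul_kronecker_mul, ← Matrix.mul_kronecker_mul,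
    ← Matrix.mul_kronecker_mul, ← Matrix.mul_kronecker_mul, (outerProj_commute a b t s).eq]
  simp only [mul_one, one_mul]

theorem charlieBlock_mul_phaseProj_mul (N : Bits k → Bits k → Matrix C C ℂ) (a : RegSub k)
    (s' : Bits k) : charlieBlock B N a s' * (phaseProj a s' ⊗ₖ 1) * charlieBlock B N a s' =
      ∑ s, ketbra (cosetState a s s') ⊗ₖ ((1 : Matrix B B ℂ) ⊗ₖ (N s s' * N s s')) := by
  have h : charlieBlock B N a s' * (phaseProj a s' ⊗ₖ 1) =
      (phaseProj a s' ⊗ₖ 1) * charlieBlock B N a s' := by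
    rw [charlieBlock, Finset.sum_mul, Finset.mul_sum]
    refine Finset.sum_congr rfl fun s _ => ?_
    rw [← Matrix.mul_kronecker_mul, ← Matrix.mul_kronecker_mul, outerProj_mul_phaseProj,
      phaseProj_mul_outerProj, mul_one, one_mul]
  rw [h, mul_assoc, charlieBlock_mul_charlieBlock, charlieBlock, Finset.mul_sum]
  refine Finset.sum_congr rfl fun s _ => ?_
  rw [← Matrix.mul_kronecker_mul, phaseProj_mul_outerProj, one_mul]

omit [DecidableEq B] in
theorem bobOp_nonneg {M : Bits k → Matrix B B ℂ} (hM : ∀ t, 0 ≤ M t) (a : RegSub k) :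
    0 ≤ bobOp M C a :=
  Finset.sum_nonneg fun t _ => kronecker_nonneg (outerProj_nonneg a t)
    (kronecker_nonneg (hM t) zero_le_one)

omit [DecidableEq C] in
theorem charlieBlock_nonneg {N : Bits k → Bits k → Matrix C C ℂ} (hN : ∀ t t', 0 ≤ N t t')
    (a : RegSub k) (s' : Bits k) : 0 ≤ charlieBlock B N a s' :=
  Finset.sum_nonneg fun t _ => kronecker_nonneg (outerProj_nonneg a t)
    (kronecker_nonneg zero_le_one (hN t s'))

theorem smul_one_eq_kronecker {X Y : Type*} [DecidableEq X] [DecidableEq Y] (c : ℝ) :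
    (c • (1 : Matrix X X ℂ)) ⊗ₖ (1 : Matrix Y Y ℂ) = c • (1 : Matrix (X × Y) (X × Y) ℂ) := by
  rw [Matrix.smul_kronecker, Matrix.one_kronecker_one]

open scoped Matrix.Norms.L2Operator in
theorem bobOp_mul_phaseProj_mul_bobOp_le {M : Bits k → Matrix B B ℂ} (hM : IsPOVM M)
    (a b : RegSub k) (s' : Bits k) :
    bobOp (fun t => CFC.sqrt (M t)) C a * (phaseProj b s' ⊗ₖ 1) *
      bobOp (fun t => CFC.sqrt (M t)) C a ≤ ((√2 / 2) ^ defect a b) ^ 2 • 1 := by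
  set K := bobOp (fun t => CFC.sqrt (M t)) C a with hK
  set X : Matrix (Bits (2 * k) × B × C) (Bits (2 * k) × B × C) ℂ := phaseProj b s' ⊗ₖ 1 with hX
  have sK : IsSelfAdjoint K :=
    IsSelfAdjoint.of_nonneg (bobOp_nonneg (fun t => CFC.sqrt_nonneg (M t)) a)
  have sX : IsSelfAdjoint X := IsSelfAdjoint.of_nonneg (kronecker_nonneg
    (Matrix.nonneg_iff_posSemidef.2 (phaseProj_posSemidef b s')) zero_le_one)
  have hXX : X * X = X := by
    rw [hX, ← Matrix.mul_kronecker_mul, phaseProj_mul_self, one_mul]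
  have hKK : K * K = bobOp M C a := by
    rw [hK, bobOp_mul_bobOp]
    congr 1
    funext t
    exact CFC.sqrt_mul_sqrt_self _ (hM.nonneg t)
  have h : X * (K * K) * X ≤ ((√2 / 2) ^ defect a b) ^ 2 • 1 := by
    rw [hKK, hX, bobOp, Finset.mul_sum, Finset.sum_mul]
    calc _ = ∑ t, (phaseProj b s' * outerProj a t * phaseProj b s') ⊗ₖ (M t ⊗ₖ 1) := by
          refine Finset.sum_congr rfl fun t _ => ?_
          rw [← Matrix.mul_kronecker_mul, ← Matrix.mul_kronecker_mul, one_mul, mul_one]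
      _ ≤ ∑ t, (((√2 / 2) ^ defect a b) ^ 2 •
            (1 : Matrix (Bits (2 * k)) (Bits (2 * k)) ℂ)) ⊗ₖ (M t ⊗ₖ 1) :=
          Finset.sum_le_sum fun t _ => kronecker_le_kronecker_right
            (kronecker_nonneg (hM.nonneg t) (zero_le_one (α := Matrix C C ℂ)))
            (phaseProj_mul_outerProj_mul_phaseProj_le a b t s')
      _ = _ := by
          rw [← kronecker_sum, ← sum_kronecker, hM.sum_eq_one, Matrix.one_kronecker_one,
            smul_one_eq_kronecker]
  exact conjugate_le_of_conjugate_le (sq_nonneg _) sK sX hXX h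

/-- Bob's operators commute with Charlie's blocks because both are diagonal on the first register,
so `K Q K` is an average of the compressions `K X K` over Charlie's measurement. -/
theorem bobOp_mul_charlieOp_mul_bobOp_le {M : Bits k → Matrix B B ℂ}
    {N : Bits k → Bits k → Matrix C C ℂ} (hM : IsPOVM M) (hN : ∀ t, IsPOVM (N t))
    (a b : RegSub k) :
    bobOp (fun t => CFC.sqrt (M t)) C a * charlieOp B N b *
      bobOp (fun t => CFC.sqrt (M t)) C a ≤ ((√2 / 2) ^ defect a b) ^ 2 • 1 := by
  set K := bobOp (fun t => CFC.sqrt (M t)) C a with hK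
  set W := charlieBlock B (fun s s' => CFC.sqrt (N s s')) b with hW
  set c := ((√2 / 2) ^ defect a b) ^ 2 with hc
  have hq : ∀ s s', CFC.sqrt (N s s') * CFC.sqrt (N s s') = N s s' := fun s s' =>
    CFC.sqrt_mul_sqrt_self _ ((hN s).nonneg s')
  have hQ : charlieOp B N b = ∑ s', W s' * (phaseProj b s' ⊗ₖ 1) * W s' := by
    rw [charlieOp, Finset.sum_comm]
    refine Finset.sum_congr rfl fun s' _ => ?_
    rw [hW, charlieBlock_mul_phaseProj_mul]
    simp only [hq]
  have hWW : ∑ s', W s' * W s' = 1 := by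
    have : ∀ s', W s' * W s' = ∑ s, outerProj b s ⊗ₖ ((1 : Matrix B B ℂ) ⊗ₖ N s s') := by
      intro s'
      rw [hW, charlieBlock_mul_charlieBlock, charlieBlock]
      simp only [hq]
    simp only [this]
    rw [Finset.sum_comm]
    simp only [← kronecker_sum, (hN _).sum_eq_one, Matrix.one_kronecker_one]
    rw [← sum_kronecker, sum_outerProj, Matrix.one_kronecker_one]
  have hcomm : ∀ s', K * W s' = W s' * K := fun s' =>
    (commute_bobOp_charlieBlock _ _ a b s').eq
  have hW0 : ∀ s', 0 ≤ W s' := charlieBlock_nonneg (fun t t' => CFC.sqrt_nonneg (N t t')) b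
  calc K * charlieOp B N b * K
      = ∑ s', W s' * (K * (phaseProj b s' ⊗ₖ 1) * K) * W s' := by
        rw [hQ, Finset.mul_sum, Finset.sum_mul]
        refine Finset.sum_congr rfl fun s' _ => ?_
        calc _ = K * W s' * (phaseProj b s' ⊗ₖ 1) * (W s' * K) := by simp only [mul_assoc]
          _ = W s' * K * (phaseProj b s' ⊗ₖ 1) * (K * W s') := by
            rw [hcomm]
          _ = _ := by simp only [mul_assoc]
    _ ≤ ∑ s', W s' * (c • 1) * W s' := Finset.sum_le_sum fun s' _ =>
        conjugate_le_conjugate_of_nonneg (bobOp_mul_phaseProj_mul_bobOp_le hM a b s') (hW0 s')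
    _ = c • 1 := by
        simp only [mul_smul_comm, smul_mul_assoc, mul_one]
        rw [← Finset.smul_sum, hWW]

open scoped Matrix.Norms.L2Operator in
/-- The leaky monogamy-of-entanglement bound in operator form. -/
theorem sum_winOp_le {M : RegSub k → Bits k → Matrix B B ℂ}
    {N : RegSub k → Bits k → Bits k → Matrix C C ℂ} (hM : ∀ a, IsPOVM (M a))
    (hN : ∀ a t, IsPOVM (N a t)) :
    ∑ a, winOp (M a) (N a) a ≤
      ((Fintype.card (RegSub k) : ℝ) * (Real.cos (Real.pi / 8) ^ 2) ^ k) • 1 := by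
  have hx : (0 : ℝ) < √2 / 2 := by positivity
  refine sum_le_of_overlap _ (fun a => winOp_nonneg (hM a) (hN a) a)
    (fun a b => (√2 / 2) ^ defect a b) (fun a b => pow_pos hx _)
    (fun a b => by rw [defect_comm]) (fun a b => ?_) (by positivity) (fun a => ?_)
  · refine norm_sqrt_mul_sqrt_le (K := bobOp (fun t => CFC.sqrt (M a t)) C a) (pow_nonneg hx.le _)
      (winOp_nonneg (hM a) (hN a) a) (winOp_nonneg (hM b) (hN b) b)
      (IsSelfAdjoint.of_nonneg (bobOp_nonneg (fun t => CFC.sqrt_nonneg (M a t)) a)) ?_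
      (winOp_le_charlieOp (hM b) (hN b) b)
      (bobOp_mul_charlieOp_mul_bobOp_le (hM a) (hN b) a b)
    rw [bobOp_mul_bobOp]
    refine (winOp_le_bobOp (hM a) (hN a) a).trans (le_of_eq ?_)
    congr 1
    funext t
    exact (CFC.sqrt_mul_sqrt_self _ ((hM a).nonneg t)).symm
  · rw [cos_pi_div_eight_sq]
    exact sum_pow_defect_le a hx.le

end Overlap

/-! ### Strong duality for state discrimination -/

section Duality

variable {S Y : Type*} [Fintype S] [Fintype Y] [DecidableEq Y]

open scoped Matrix.Norms.L2Operator in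
variable (S Y) in
theorem isCompact_setOf_isPOVM : IsCompact {N : S → Matrix Y Y ℂ | IsPOVM N} := by
  have hset : {N : S → Matrix Y Y ℂ | IsPOVM N} =
      (⋂ s, {N : S → Matrix Y Y ℂ | 0 ≤ N s}) ∩ {N | ∑ s, N s = 1} := by
    ext N
    simp only [Set.mem_ofPred_eq, Set.mem_inter_iff, Set.mem_iInter]
    exact ⟨fun h => ⟨h.nonneg, h.sum_eq_one⟩,
      fun h => ⟨fun s => Matrix.nonneg_iff_posSemidef.1 (h.1 s), h.2⟩⟩
  have : ProperSpace (S → Matrix Y Y ℂ) := FiniteDimensional.proper ℂ _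
  refine Metric.isCompact_of_isClosed_isBounded ?_ ?_
  · rw [hset]
    refine (isClosed_iInter fun s => ?_).inter ?_
    · exact isClosed_le continuous_const (continuous_apply s)
    · exact isClosed_eq (continuous_finsetSum _ fun s _ => continuous_apply s) continuous_const
  · refine isBounded_iff_forall_norm_le.2 ⟨1, fun N hN => ?_⟩
    exact (pi_norm_le_iff_of_nonneg zero_le_one).2 fun s =>
      (CStarAlgebra.norm_le_one_iff_of_nonneg _ (hN.nonneg s)).2 (hN.le_one s)

theorem exists_isMaxOn_isPOVM [Nonempty S] (τ : S → Matrix Y Y ℂ) :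
    ∃ N : S → Matrix Y Y ℂ, IsPOVM N ∧ ∀ N' : S → Matrix Y Y ℂ, IsPOVM N' →
      (∑ s, (N' s * τ s).trace).re ≤ (∑ s, (N s * τ s).trace).re := by
  classical
  obtain ⟨r⟩ := ‹Nonempty S›
  have hne : {N : S → Matrix Y Y ℂ | IsPOVM N}.Nonempty := by
    refine ⟨Pi.single r 1, fun s => ?_, by simp⟩
    by_cases h : s = r
    · subst h; rw [Pi.single_eq_same]; exact Matrix.PosSemidef.one
    · rw [Pi.single_eq_of_ne h]; exact Matrix.PosSemidef.zero
  have hcont : Continuous fun N : S → Matrix Y Y ℂ => (∑ s, (N s * τ s).trace).re :=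
    Complex.continuous_re.comp (continuous_finsetSum _ fun s _ =>
      ((continuous_apply s).matrix_mul continuous_const).matrix_trace)
  obtain ⟨N, hN, hmax⟩ := (isCompact_setOf_isPOVM S Y).exists_isMaxOn hne hcont.continuousOn
  exact ⟨N, hN, fun N' hN' => hmax hN'⟩

theorem nonpos_of_forall_mul_add_sq_mul_nonpos {l q δ : ℝ} (hδ : 0 < δ)
    (h : ∀ ε, 0 < ε → ε ≤ δ → ε * l + ε ^ 2 * q ≤ 0) : l ≤ 0 := by
  by_contra! hl
  have hε : 0 < min δ (l / (2 * (|q| + 1))) := lt_min hδ (by positivity)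
  set ε := min δ (l / (2 * (|q| + 1))) with hdef
  have h1 := h ε hε (min_le_left _ _)
  have h2 : ε * (2 * (|q| + 1)) ≤ l := (le_div_iff₀ (by positivity)).1 (min_le_right _ _)
  have h3 : l + ε * q ≤ 0 := by
    have : ε * (l + ε * q) ≤ 0 := by linarith [h1, show ε * (l + ε * q) = ε * l + ε ^ 2 * q by ring]
    exact nonpos_of_mul_nonpos_right this hε
  nlinarith [neg_abs_le q, abs_nonneg q]

omit [DecidableEq Y] in
theorem ketbra_mul_self (v : Y → ℂ) :
    ketbra v * ketbra v = (star v ⬝ᵥ v) • ketbra v := by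
  rw [ketbra, Matrix.vecMulVec_mul_vecMulVec, Matrix.vecMulVec_smul]

omit [DecidableEq Y] in
theorem trace_ketbra_mul (v : Y → ℂ) (P : Matrix Y Y ℂ) :
    (ketbra v * P).trace = star v ⬝ᵥ P.mulVec v := by
  rw [ketbra, Matrix.vecMulVec_mul, Matrix.trace_vecMulVec, dotProduct_comm,
    Matrix.dotProduct_mulVec]

omit [DecidableEq Y] in
theorem posSemidef_of_trace_ketbra_mul {P : Matrix Y Y ℂ} (hP : P.IsHermitian)
    (h : ∀ v, 0 ≤ (ketbra v * P).trace.re) : P.PosSemidef := by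
  refine Matrix.posSemidef_iff_dotProduct_mulVec.2 ⟨hP, fun v => ?_⟩
  rw [← trace_ketbra_mul, Complex.nonneg_iff]
  refine ⟨h v, ?_⟩
  rw [trace_ketbra_mul]
  exact (hP.im_star_dotProduct_mulVec_self v).symm

/-- Transferring to the outcome `r` the part of every outcome seen through `1 - E²`. -/
theorem IsPOVM.transfer [DecidableEq S] {N : S → Matrix Y Y ℂ} (hN : IsPOVM N)
    {E : Matrix Y Y ℂ} (hE : E.IsHermitian) (hE1 : E * E ≤ 1) (r : S) :
    IsPOVM fun s => E * N s * E + if s = r then 1 - E * E else 0 := by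
  refine ⟨fun s => Matrix.nonneg_iff_posSemidef.1 (add_nonneg ?_ ?_), ?_⟩
  · exact IsSelfAdjoint.conjugate_nonneg (hN.nonneg s) hE
  · split_ifs
    · exact sub_nonneg.2 hE1
    · exact le_rfl
  · rw [Finset.sum_add_distrib, ← Finset.sum_mul, ← Finset.mul_sum, hN.sum_eq_one,
      Finset.sum_ite_eq' Finset.univ r]
    simp

/-- Strong duality for state discrimination: the guessing value of the best measurement equals the
trace of an operator that dominates every `τ s`. The operator is the Hermitian part of
`∑ s, N s * τ s`, for an optimal measurement `N`: perturbing `N` in the direction of a vector `v`,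
to first order, shows that it dominates. -/
theorem exists_isPOVM_dominating [Nonempty S] (τ : S → Matrix Y Y ℂ)
    (hτ : ∀ s, (τ s).IsHermitian) :
    ∃ N : S → Matrix Y Y ℂ, IsPOVM N ∧ ∃ ω : Matrix Y Y ℂ, (∀ s, (ω - τ s).PosSemidef) ∧
      ω.trace.re = (∑ s, (N s * τ s).trace).re := by
  classical
  obtain ⟨N, hN, hmax⟩ := exists_isMaxOn_isPOVM τ
  set w := ∑ s, N s * τ s with hw
  have hwstar : star w = ∑ s, τ s * N s := by
    rw [hw, star_sum]
    exact Finset.sum_congr rfl fun s _ => by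
      rw [star_mul, (IsSelfAdjoint.of_nonneg (hN.nonneg s)).star_eq,
        (show IsSelfAdjoint (τ s) from hτ s).star_eq]
  refine ⟨N, hN, (2⁻¹ : ℝ) • (w + star w),
    fun r => posSemidef_of_trace_ketbra_mul ?_ fun v => ?_, ?_⟩
  · refine Matrix.IsHermitian.sub ?_ (hτ r)
    rw [Matrix.IsHermitian, ← Matrix.star_eq_conjTranspose, star_smul, star_trivial, star_add,
      star_star, add_comm]
  · set V := ketbra v with hV
    have hVh : V.IsHermitian := (posSemidef_ketbra v).isHermitian
    obtain ⟨n, hn0, hn⟩ : ∃ n : ℝ, 0 ≤ n ∧ V * V = n • V := by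
      refine ⟨(star v ⬝ᵥ v).re, (Complex.nonneg_iff.1 (dotProduct_star_self_nonneg v)).1, ?_⟩
      rw [hV, ketbra_mul_self, ← Complex.coe_smul]
      congr 1
      exact Complex.ext rfl (Complex.nonneg_iff.1 (dotProduct_star_self_nonneg v)).2.symm
    -- The gain from replacing `N s` by `E * N s * E` and adding `1 - E²` to `N r`, where
    -- `E = 1 - ε V`, is at most `0`; it is a polynomial in `ε` without constant term.
    have key : ∀ ε : ℝ, 0 < ε → ε ≤ 2 / (n + 1) →
        ε * (2 * (V * τ r).trace.re - ∑ s, ((V * (N s * τ s)).trace.re +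
          (V * (τ s * N s)).trace.re)) +
          ε ^ 2 * (∑ s, (V * N s * V * τ s).trace.re - (V * V * τ r).trace.re) ≤ 0 := by
      intro ε hε hεn
      set E : Matrix Y Y ℂ := 1 - ε • V with hE
      have hEh : E.IsHermitian := by
        refine Matrix.isHermitian_one.sub ?_
        rw [Matrix.IsHermitian, Matrix.conjTranspose_smul, hVh.eq, star_trivial]
      have hEE : 1 - E * E = (2 * ε) • V - ε ^ 2 • (V * V) := by
        simp only [hE, mul_sub, sub_mul, mul_one, one_mul, smul_mul_assoc, mul_smul_comm,
          mul_smul, pow_two, two_mul, add_smul, smul_sub]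
        abel
      have hE1 : E * E ≤ 1 := by
        rw [← sub_nonneg, hEE, hn, smul_smul, ← sub_smul]
        refine smul_nonneg ?_ (ketbra_nonneg v)
        rw [le_div_iff₀ (by positivity)] at hεn
        nlinarith
      have h := hmax _ (hN.transfer hEh hE1 r)
      have e1 : ∀ s, (E * N s * E * τ s).trace = (N s * τ s).trace -
          ε * ((V * (N s * τ s)).trace + (V * (τ s * N s)).trace) +
          ε ^ 2 * (V * N s * V * τ s).trace := by
        intro s
        have : (N s * V * τ s).trace = (V * (τ s * N s)).trace := by
          rw [mul_assoc, Matrix.trace_mul_comm, mul_assoc]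
        rw [← this]
        simp only [hE, mul_sub, sub_mul, mul_one, one_mul, smul_mul_assoc, mul_smul_comm,
          Matrix.trace_sub, Matrix.trace_smul, Complex.real_smul, mul_assoc]
        ring
      have e2 : ((1 - E * E) * τ r).trace = ε * (2 * (V * τ r).trace) -
          ε ^ 2 * (V * V * τ r).trace := by
        rw [hEE]
        simp only [sub_mul, smul_mul_assoc, Matrix.trace_sub, Matrix.trace_smul, Complex.real_smul]
        push_cast
        ring
      simp only [add_mul, ite_mul, zero_mul, Matrix.trace_add, Finset.sum_add_distrib] at h
      have e3 : ∑ s, (if s = r then (1 - E * E) * τ s else 0).trace =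
          ((1 - E * E) * τ r).trace := by
        rw [Finset.sum_eq_single r (fun s _ hs => by rw [if_neg hs, Matrix.trace_zero])
          (by simp), if_pos rfl]
      rw [e3, e2] at h
      simp only [e1] at h
      simp only [← Complex.ofReal_pow] at h
      simp only [Finset.sum_add_distrib, Finset.sum_sub_distrib, ← Finset.mul_sum, Complex.add_re,
        Complex.sub_re, Complex.re_ofReal_mul, Complex.re_sum] at h
      have : (2 * (V * τ r).trace).re = 2 * (V * τ r).trace.re := by simp
      rw [this] at h
      simp only [Finset.sum_add_distrib]
      linarith
    have hl := nonpos_of_forall_mul_add_sq_mul_nonpos (δ := 2 / (n + 1)) (by positivity) key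
    rw [mul_sub, mul_smul_comm, mul_add, hwstar, hw, Finset.mul_sum, Finset.mul_sum]
    simp only [Matrix.trace_sub, Matrix.trace_smul, Matrix.trace_add, Matrix.trace_sum,
      Complex.sub_re, Complex.real_smul, Complex.re_ofReal_mul, Complex.add_re, Complex.re_sum]
    rw [Finset.sum_add_distrib] at hl
    linarith
  · rw [Matrix.trace_smul, Matrix.trace_add, Matrix.star_eq_conjTranspose,
      Matrix.trace_conjTranspose, Complex.real_smul, Complex.re_ofReal_mul, Complex.add_re,
      hw, Matrix.trace_sum]
    simp only [RCLike.star_def, Complex.conj_re]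
    ring

end Duality

/-! ### Choi operators of channels -/

section Channels

variable {X Y : Type*} [Fintype X] [DecidableEq X] [Fintype Y] [DecidableEq Y]

omit [DecidableEq X] [DecidableEq Y] in
theorem IsChannel.map_posSemidef {Φ : Matrix X X ℂ →ₗ[ℂ] Matrix Y Y ℂ} (hΦ : IsChannel Φ)
    {P : Matrix X X ℂ} (hP : P.PosSemidef) : (Φ P).PosSemidef :=
  (hΦ.completelyPositive 1 _ (hP.submatrix Prod.snd)).submatrix (fun y => ((0 : Fin 1), y))

/-- The unnormalised Choi operator of a linear map `Φ` on operators. -/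
def choi (Φ : Matrix X X ℂ →ₗ[ℂ] Matrix Y Y ℂ) : Matrix (X × Y) (X × Y) ℂ :=
  fun i j => Φ (Matrix.single i.1 j.1 1) i.2 j.2

omit [DecidableEq Y] in
theorem IsChannel.choi_posSemidef {Φ : Matrix X X ℂ →ₗ[ℂ] Matrix Y Y ℂ} (hΦ : IsChannel Φ) :
    (choi Φ).PosSemidef := by
  let e := Fintype.equivFin X
  have h := (hΦ.completelyPositive (Fintype.card X) _
    (posSemidef_ketbra fun i : Fin (Fintype.card X) × X => if e i.2 = i.1 then 1 else 0)).submatrix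
      (fun i : X × Y => (e i.1, i.2))
  convert h using 1
  ext i j
  have hs : Matrix.single i.1 j.1 (1 : ℂ) = fun x x' =>
      ketbra (fun i : Fin (Fintype.card X) × X => if e i.2 = i.1 then (1 : ℂ) else 0)
        (e i.1, x) (e j.1, x') := by
    ext x x'
    simp only [ketbra, Matrix.vecMulVec_apply, Matrix.single_apply, Pi.star_apply,
      EmbeddingLike.apply_eq_iff_eq, ite_and, eq_comm]
    split_ifs <;> simp
  simp only [choi, amplify, Matrix.submatrix_apply, hs]

omit [DecidableEq Y] in
theorem trace_kronecker_mul_choi (Φ : Matrix X X ℂ →ₗ[ℂ] Matrix Y Y ℂ) (P : Matrix X X ℂ)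
    (Q : Matrix Y Y ℂ) : ((P ⊗ₖ Q) * choi Φ).trace = (Q * Φ P.transpose).trace := by
  have h : Φ P.transpose = ∑ x, ∑ x', P x x' • Φ (Matrix.single x' x 1) := by
    conv_lhs => rw [Matrix.matrix_eq_sum_single P.transpose]
    rw [map_sum, Finset.sum_comm]
    simp only [map_sum]
    refine Finset.sum_congr rfl fun x _ => Finset.sum_congr rfl fun x' _ => ?_
    rw [← map_smul, Matrix.smul_single, smul_eq_mul, mul_one, Matrix.transpose_apply]
  rw [h, Finset.mul_sum, Matrix.trace_sum]
  simp only [Matrix.trace, Matrix.diag_apply, Matrix.mul_apply, Fintype.sum_prod_type,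
    Matrix.kroneckerMap_apply, choi, Matrix.sum_apply, Matrix.smul_apply, smul_eq_mul]
  refine Finset.sum_congr rfl fun x _ => Finset.sum_congr rfl fun y _ => ?_
  simp only [Finset.mul_sum]
  rw [Finset.sum_comm]
  refine Finset.sum_congr rfl fun y' _ => Finset.sum_congr rfl fun x' _ => by ring

theorem IsChannel.trace_choi {Φ : Matrix X X ℂ →ₗ[ℂ] Matrix Y Y ℂ} (hΦ : IsChannel Φ) :
    (choi Φ).trace = Fintype.card X := by
  have h := trace_kronecker_mul_choi Φ 1 1
  rwa [Matrix.one_kronecker_one, one_mul, one_mul, Matrix.transpose_one,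
    hΦ.tracePreserving 1 Matrix.PosSemidef.one, Matrix.trace_one] at h

theorem re_trace_mul_le {P J : Matrix X X ℂ} {r : ℝ} (hP : P ≤ r • 1) (hJ : J.PosSemidef) :
    (P * J).trace.re ≤ r * J.trace.re := by
  have h1 : 0 ≤ CFC.sqrt J * (r • 1 - P) * CFC.sqrt J :=
    conjugate_nonneg_of_nonneg (sub_nonneg.2 hP) (CFC.sqrt_nonneg J)
  have h2 := (Complex.nonneg_iff.1 (Matrix.nonneg_iff_posSemidef.1 h1).trace_nonneg).1
  rw [Matrix.trace_mul_comm, ← mul_assoc,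
    CFC.sqrt_mul_sqrt_self J (Matrix.nonneg_iff_posSemidef.2 hJ), Matrix.trace_mul_comm, sub_mul,
    smul_mul_assoc, one_mul, Matrix.trace_sub, Matrix.trace_smul, Complex.sub_re, Complex.real_smul,
    Complex.re_ofReal_mul] at h2
  linarith

end Channels

/-! ### The value of the game -/

section Game

variable {k : ℕ} {B C : Type*} [Fintype B] [DecidableEq B] [Fintype C] [DecidableEq C]

theorem transpose_ketbra_cosetState (a : RegSub k) (t t' : Bits k) :
    (ketbra (cosetState a t t')).transpose = ketbra (cosetState a t t') := by
  ext v w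
  rw [Matrix.transpose_apply, ketbra_cosetState_apply, ketbra_cosetState_apply,
    add_comm (innerBits a w)]
  simp only [and_comm]

theorem card_bits (n : ℕ) : Fintype.card (Bits n) = 2 ^ n := by
  rw [Fintype.card_fun, ZMod.card, Fintype.card_fin]

/-- The value of the leaky monogamy-of-entanglement game, without the normalising factor. -/
theorem game_value_le {Φ : Matrix (Bits (2 * k)) (Bits (2 * k)) ℂ →ₗ[ℂ] Matrix (B × C) (B × C) ℂ}
    (hΦ : IsChannel Φ) {M : RegSub k → Bits k → Matrix B B ℂ}
    {N : RegSub k → Bits k → Bits k → Matrix C C ℂ} (hM : ∀ a, IsPOVM (M a))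
    (hN : ∀ a t, IsPOVM (N a t)) :
    (∑ a, ∑ t, ∑ t', ((M a t ⊗ₖ N a t t') * Φ (ketbra (cosetState a t t'))).trace).re ≤
      Fintype.card (RegSub k) * (Real.cos (Real.pi / 8) ^ 2) ^ k * (2 ^ k * 2 ^ k) := by
  have h := re_trace_mul_le (sum_winOp_le hM hN) hΦ.choi_posSemidef
  rw [hΦ.trace_choi, card_bits, Finset.sum_mul, Matrix.trace_sum] at h
  simp only [winOp, Finset.sum_mul, Matrix.trace_sum, trace_kronecker_mul_choi,
    transpose_ketbra_cosetState] at h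
  refine h.trans (le_of_eq ?_)
  rw [two_mul, pow_add]
  congr 1
  norm_cast

/-- A shift of `t` by a fixed error `u`, which the players are free to know, does not change the
value of the game: it only relabels the outcomes of the measurements. -/
theorem shifted_game_value_le
    {Φ : Matrix (Bits (2 * k)) (Bits (2 * k)) ℂ →ₗ[ℂ] Matrix (B × C) (B × C) ℂ}
    (hΦ : IsChannel Φ) {M : RegSub k → Bits k → Matrix B B ℂ}
    {N : RegSub k → Bits k → Bits k → Matrix C C ℂ} (hM : ∀ a, IsPOVM (M a))
    (hN : ∀ a t, IsPOVM (N a t)) (u : Bits k) :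
    (∑ a, ∑ t, ∑ t', ((M a t ⊗ₖ N a t t') * Φ (ketbra (cosetState a (t + u) t'))).trace).re ≤
      Fintype.card (RegSub k) * (Real.cos (Real.pi / 8) ^ 2) ^ k * (2 ^ k * 2 ^ k) := by
  have h := game_value_le hΦ (M := fun a t => M a (t - u)) (N := fun a t => N a (t - u))
    (fun a => ⟨fun t => (hM a).posSemidef _, by
      rw [← (hM a).sum_eq_one]; exact (Equiv.subRight u).sum_comp (M a)⟩) (fun a t => hN a _)
  refine le_trans (le_of_eq ?_) h
  congr 1
  refine Finset.sum_congr rfl fun a _ => ?_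
  refine Fintype.sum_equiv (Equiv.addRight u) _ _ fun t => ?_
  simp

end Game

/-! ### The partial state on a correct guess -/

section States

section
variable {X Q R : Type*} [Fintype X] [DecidableEq X] [Fintype Q] [DecidableEq Q]
  [Fintype R] [DecidableEq R]

theorem pt_posSemidef (x : X) : (pt x).PosSemidef := by
  have : pt x = ketbra (Pi.single x 1) := by
    ext i j
    simp only [pt, ketbra, Matrix.single_apply, Matrix.vecMulVec_apply, Pi.star_apply,
      Pi.single_apply, ite_and, eq_comm]
    split_ifs <;> simp
  rw [this]
  exact posSemidef_ketbra _

omit [Fintype X] [DecidableEq X] in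
theorem traceFst_posSemidef {E : Type*} [Fintype E] {ρ : Matrix (E × X) (E × X) ℂ}
    (hρ : ρ.PosSemidef) : (traceFst ρ).PosSemidef := by
  have : traceFst ρ = ∑ e, ρ.submatrix (fun i => (e, i)) (fun i => (e, i)) := by
    ext i j; simp [traceFst, Matrix.sum_apply]
  rw [this]
  exact Matrix.posSemidef_sum _ fun e _ => hρ.submatrix _

omit [DecidableEq X] in
theorem conjugate_posSemidef {P ρ : Matrix X X ℂ} (hP : P.PosSemidef) (hρ : ρ.PosSemidef) :
    (P * ρ * P).PosSemidef := by
  have h := hρ.mul_mul_conjTranspose_same P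
  rwa [hP.isHermitian.eq] at h

theorem andGuess_posSemidef (M : X → Matrix Q Q ℂ) {ρ : Matrix (X × Q × R) (X × Q × R) ℂ}
    (hρ : ρ.PosSemidef) : (andGuess M ρ).PosSemidef := by
  refine traceFst_posSemidef (Matrix.posSemidef_sum _ fun x _ => conjugate_posSemidef
    ((pt_posSemidef x).kronecker ((pt_posSemidef x).kronecker Matrix.PosSemidef.one)) ?_)
  refine Matrix.posSemidef_sum _ fun s _ => (pt_posSemidef s).kronecker
    (conjugate_posSemidef (Matrix.PosSemidef.one.kronecker (Matrix.PosSemidef.kronecker ?_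
      Matrix.PosSemidef.one)) hρ)
  exact Matrix.nonneg_iff_posSemidef.1 (CFC.sqrt_nonneg (M s))

omit [Fintype X] in
theorem pt_kronecker_pt_kronecker_one {Z : Type*} [DecidableEq Z] (x : X) :
    pt x ⊗ₖ (pt x ⊗ₖ (1 : Matrix Z Z ℂ)) =
      Matrix.diagonal fun i => if i.1 = x ∧ i.2.1 = x then 1 else 0 := by
  have h : pt x = Matrix.diagonal fun y => if y = x then (1 : ℂ) else 0 := by
    ext i j
    simp only [pt, Matrix.single_apply, Matrix.diagonal_apply, eq_comm, ite_and]
    split_ifs with h1 h2 h3 <;> simp_all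
  rw [h, ← Matrix.diagonal_one, Matrix.diagonal_kronecker_diagonal,
    Matrix.diagonal_kronecker_diagonal]
  congr 1
  funext i
  rw [ite_and]
  split_ifs <;> simp

theorem andGuess_apply (M : X → Matrix Q Q ℂ) (ρ : Matrix (X × Q × R) (X × Q × R) ℂ)
    (x y : X) (i j : Q × R) : andGuess M ρ (x, i) (y, j) = if x = y then
      (((1 : Matrix X X ℂ) ⊗ₖ (CFC.sqrt (M x) ⊗ₖ (1 : Matrix R R ℂ))) * ρ *
        ((1 : Matrix X X ℂ) ⊗ₖ (CFC.sqrt (M x) ⊗ₖ (1 : Matrix R R ℂ)))) (x, i) (x, j) else 0 := by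
  have hnd : ∀ s i j, nondestructive M ρ (s, i) (s, j) =
      (((1 : Matrix X X ℂ) ⊗ₖ (CFC.sqrt (M s) ⊗ₖ (1 : Matrix R R ℂ))) * ρ *
        ((1 : Matrix X X ℂ) ⊗ₖ (CFC.sqrt (M s) ⊗ₖ (1 : Matrix R R ℂ)))) i j := by
    intro s i j
    rw [nondestructive, Matrix.sum_apply, Finset.sum_eq_single s]
    · simp [pt, Matrix.kroneckerMap_apply]
    · intro s' _ hs
      simp [pt, Matrix.kroneckerMap_apply, hs]
    · simp
  rw [andGuess, traceFst]
  simp only [pt_kronecker_pt_kronecker_one, Matrix.sum_apply, Matrix.mul_diagonal,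
    Matrix.diagonal_mul]
  split_ifs with h
  · subst h
    rw [Finset.sum_eq_single x, Finset.sum_eq_single x]
    · simp [hnd]
    · intro z _ hz; rw [if_neg (fun h => hz h.1.symm)]; simp
    · simp
    · intro z _ hz
      refine Finset.sum_eq_zero fun w _ => ?_
      rw [if_neg (fun h => hz (h.1.trans h.2.symm))]; simp
    · simp
  · refine Finset.sum_eq_zero fun z _ => Finset.sum_eq_zero fun w _ => ?_
    by_cases hx : x = w
    · subst hx
      rw [if_neg (c := z = x ∧ y = x) (fun h' => h h'.2.symm), mul_zero]
    · rw [if_neg (c := z = w ∧ x = w) (fun h' => hx h'.2), zero_mul, zero_mul]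

omit [DecidableEq Q] in
theorem one_kronecker_mul_apply (P : Matrix Q Q ℂ) (ρ : Matrix (X × Q × R) (X × Q × R) ℂ)
    (x : X) (q : Q) (r : R) (j : X × Q × R) :
    (((1 : Matrix X X ℂ) ⊗ₖ (P ⊗ₖ (1 : Matrix R R ℂ))) * ρ) (x, q, r) j =
      ∑ q', P q q' * ρ (x, q', r) j := by
  simp [Matrix.mul_apply, Fintype.sum_prod_type, Matrix.kroneckerMap_apply, Matrix.one_apply]

omit [DecidableEq Q] in
theorem mul_one_kronecker_apply (P : Matrix Q Q ℂ) (ρ : Matrix (X × Q × R) (X × Q × R) ℂ)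
    (x : X) (q : Q) (r : R) (j : X × Q × R) :
    (ρ * ((1 : Matrix X X ℂ) ⊗ₖ (P ⊗ₖ (1 : Matrix R R ℂ)))) j (x, q, r) =
      ∑ q', ρ j (x, q', r) * P q' q := by
  simp [Matrix.mul_apply, Fintype.sum_prod_type, Matrix.kroneckerMap_apply, Matrix.one_apply]

/-- After the measured register is traced out, only `M x` enters, not its square root. -/
theorem sum_andGuess_apply {M : X → Matrix Q Q ℂ} (hM : IsPOVM M)
    (ρ : Matrix (X × Q × R) (X × Q × R) ℂ) (x y : X) (r r' : R) :
    ∑ q, andGuess M ρ (x, q, r) (y, q, r') =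
      if x = y then ∑ q, ∑ q', M x q' q * ρ (x, q, r) (x, q', r') else 0 := by
  simp only [andGuess_apply]
  split_ifs
  · simp only [mul_one_kronecker_apply, one_kronecker_mul_apply, Finset.sum_mul]
    have h : ∀ q' q, M x q' q = ∑ p, CFC.sqrt (M x) q' p * CFC.sqrt (M x) p q := by
      intro q' q
      rw [← Matrix.mul_apply, CFC.sqrt_mul_sqrt_self _ (hM.nonneg x)]
    simp only [h, Finset.sum_mul]
    rw [Finset.sum_comm]
    rw [Finset.sum_comm (γ := Q) (f := fun q q' => ∑ p, CFC.sqrt (M x) q' p *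
      CFC.sqrt (M x) p q * ρ (x, q, r) (x, q', r'))]
    refine Finset.sum_congr rfl fun q' _ => ?_
    rw [Finset.sum_comm]
    refine Finset.sum_congr rfl fun q _ => Finset.sum_congr rfl fun p _ => by ring
  · simp

end

end States

/-! ### Charlie's guessing probability -/

section RobustState

theorem pt_apply {X : Type*} [DecidableEq X] (x y z : X) :
    pt x y z = if x = y ∧ x = z then 1 else 0 := Matrix.single_apply _ _ _ _ _

/-- The number of values of `a`, `t`, `t'` and `u` over which the state of the game is averaged. -/
def gameCount (k m : ℕ) : ℝ :=
  Fintype.card (RegSub k) * Fintype.card (Bits k) * Fintype.card (Bits k) * (ball k m).card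

variable {k m : ℕ} {B C : Type*}

theorem gameState_apply (Φ : Matrix (Bits (2 * k)) (Bits (2 * k)) ℂ →ₗ[ℂ] Matrix (B × C) (B × C) ℂ)
    (a a' b b' : RegSub k) (t t' s s' : Bits k) (i j : B × C) :
    gameState k m Φ ((a, a', t, t'), i) ((b, b', s, s'), j) =
      if a = b ∧ a' = b' ∧ t = s ∧ t' = s' ∧ a = a' then
        (((gameCount k m)⁻¹ : ℝ) : ℂ) *
          (∑ u ∈ ball k m, Φ (ketbra (cosetState a (t + u) t'))) i j
      else 0 := by
  rw [gameState, gameCount]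
  push_cast
  rw [Matrix.smul_apply, smul_eq_mul]
  simp only [Matrix.sum_apply, Matrix.kroneckerMap_apply, pt_apply, ite_mul, one_mul, zero_mul,
    Prod.mk.injEq]
  by_cases h : a = b ∧ a' = b' ∧ t = s ∧ t' = s' ∧ a = a'
  · obtain ⟨rfl, rfl, rfl, rfl, rfl⟩ := h
    simp only [and_self, if_true]
    congr 1
    rw [Finset.sum_eq_single a, Finset.sum_eq_single t, Finset.sum_eq_single t']
    · simp
    · intro z _ hz; simp [hz]
    · simp
    · intro z _ hz; simp [hz]
    · simp
    · intro z _ hz; simp [hz]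
    · simp
  · rw [if_neg h]
    refine mul_eq_zero_of_right _ ?_
    refine Finset.sum_eq_zero fun x _ => Finset.sum_eq_zero fun y _ => Finset.sum_eq_zero
      fun z _ => Finset.sum_eq_zero fun u _ => if_neg ?_
    rintro ⟨⟨rfl, rfl, rfl, rfl⟩, rfl, rfl, rfl, rfl⟩
    exact h ⟨rfl, rfl, rfl, rfl, rfl⟩

variable [Fintype B] [DecidableEq B] [Fintype C] [DecidableEq C]

omit [DecidableEq B] [DecidableEq C] in
theorem gameState_posSemidef
    {Φ : Matrix (Bits (2 * k)) (Bits (2 * k)) ℂ →ₗ[ℂ] Matrix (B × C) (B × C) ℂ}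
    (hΦ : IsChannel Φ) : (gameState k m Φ).PosSemidef := by
  refine Matrix.PosSemidef.smul (Matrix.posSemidef_sum _ fun a _ => Matrix.posSemidef_sum _
    fun t _ => Matrix.posSemidef_sum _ fun t' _ => Matrix.posSemidef_sum _ fun u _ =>
      (pt_posSemidef _).kronecker (hΦ.map_posSemidef (posSemidef_ketbra _))) ?_
  positivity

omit [DecidableEq B] [DecidableEq C] in
theorem robustState_posSemidef
    {Φ : Matrix (Bits (2 * k)) (Bits (2 * k)) ℂ →ₗ[ℂ] Matrix (B × C) (B × C) ℂ}
    (hΦ : IsChannel Φ) : (robustState k m Φ).PosSemidef :=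
  (gameState_posSemidef hΦ).submatrix _

/-- The part of `M t` that Bob applies when the register `A` holds `a`. -/
def bobPOVM (M : Bits k → Matrix (RegSub k × B) (RegSub k × B) ℂ) (a : RegSub k) (t : Bits k) :
    Matrix B B ℂ := (M t).submatrix (fun b => (a, b)) (fun b => (a, b))

theorem IsPOVM.submatrix {S X Z : Type*} [Fintype S] [Fintype X] [DecidableEq X] [Fintype Z]
    [DecidableEq Z] {P : S → Matrix X X ℂ} (hP : IsPOVM P) {f : Z → X}
    (hf : Function.Injective f) : IsPOVM fun s => (P s).submatrix f f := by
  refine ⟨fun s => (hP.posSemidef s).submatrix f, ?_⟩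
  rw [← Matrix.submatrix_one f hf, ← hP.sum_eq_one]
  ext i j
  simp [Matrix.sum_apply]

/-- The partial trace over `B` of `(P ⊗ 1) F`. -/
def traceBob (P : Matrix B B ℂ) (F : Matrix (B × C) (B × C) ℂ) : Matrix C C ℂ :=
  fun c c' => ∑ b, ∑ b', P b' b * F (b, c) (b', c')

omit [DecidableEq B] [DecidableEq C] in
theorem trace_mul_traceBob (P : Matrix B B ℂ) (Q : Matrix C C ℂ) (F : Matrix (B × C) (B × C) ℂ) :
    (Q * traceBob P F).trace = ((P ⊗ₖ Q) * F).trace := by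
  simp only [Matrix.trace, Matrix.diag_apply, Matrix.mul_apply, Fintype.sum_prod_type,
    Matrix.kroneckerMap_apply, traceBob, Finset.mul_sum]
  rw [Finset.sum_comm (γ := B)]
  refine Finset.sum_congr rfl fun c _ => ?_
  calc _ = ∑ b, ∑ c', ∑ b', Q c c' * (P b' b * F (b, c') (b', c)) := Finset.sum_comm
    _ = ∑ b, ∑ b', ∑ c', Q c c' * (P b' b * F (b, c') (b', c)) :=
      Finset.sum_congr rfl fun b _ => Finset.sum_comm
    _ = ∑ b', ∑ b, ∑ c', Q c c' * (P b' b * F (b, c') (b', c)) := Finset.sum_comm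
    _ = _ := Finset.sum_congr rfl fun b' _ => Finset.sum_congr rfl fun b _ =>
      Finset.sum_congr rfl fun c' _ => by ring

theorem charlieView_andGuess_apply
    (Φ : Matrix (Bits (2 * k)) (Bits (2 * k)) ℂ →ₗ[ℂ] Matrix (B × C) (B × C) ℂ)
    {M : Bits k → Matrix (RegSub k × B) (RegSub k × B) ℂ} (hM : IsPOVM M)
    (t t' s s' : Bits k) (a b : RegSub k) (c d : C) :
    charlieView (andGuess M (robustState k m Φ)) (t', a, t, c) (s', b, s, d) =
      if t' = s' ∧ a = b ∧ t = s then
        (((gameCount k m)⁻¹ : ℝ) : ℂ) *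
          traceBob (bobPOVM M a t) (∑ u ∈ ball k m, Φ (ketbra (cosetState a (t + u) t'))) c d
      else 0 := by
  have h : charlieView (andGuess M (robustState k m Φ)) (t', a, t, c) (s', b, s, d) =
      ∑ q, andGuess M (robustState k m Φ) (t, q, (t', a, c)) (s, q, (s', b, d)) := rfl
  rw [h, sum_andGuess_apply hM]
  by_cases hts : t = s
  · subst hts
    simp only [if_true, and_true, Fintype.sum_prod_type]
    have hr : ∀ a₁ b₁ a₂ b₂, robustState k m Φ (t, (a₁, b₁), (t', a, c)) (t, (a₂, b₂), (s', b, d)) =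
        if a₁ = a₂ ∧ a = b ∧ t = t ∧ t' = s' ∧ a₁ = a then
          (((gameCount k m)⁻¹ : ℝ) : ℂ) *
            (∑ u ∈ ball k m, Φ (ketbra (cosetState a₁ (t + u) t'))) (b₁, c) (b₂, d)
        else 0 := fun a₁ b₁ a₂ b₂ => gameState_apply Φ _ _ _ _ _ _ _ _ _ _
    simp only [hr]
    by_cases h2 : t' = s' ∧ a = b
    · obtain ⟨rfl, rfl⟩ := h2
      simp only [true_and, and_true, if_true]
      rw [Finset.sum_eq_single a]
      · simp only [traceBob, bobPOVM, Matrix.submatrix_apply, and_true]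
        rw [Finset.mul_sum]
        refine Finset.sum_congr rfl fun b₁ _ => ?_
        rw [Finset.sum_eq_single a, Finset.mul_sum]
        · refine Finset.sum_congr rfl fun b₂ _ => ?_
          rw [if_pos rfl, mul_left_comm]
        · intro z _ hz; simp [hz.symm]
        · simp
      · intro z _ hz; simp [hz]
      · simp
    · rw [if_neg h2]
      refine Finset.sum_eq_zero fun x _ => Finset.sum_eq_zero fun y _ => Finset.sum_eq_zero
        fun z _ => Finset.sum_eq_zero fun u _ => ?_
      rw [if_neg (fun h => h2 ⟨h.2.2.2.1, h.2.1⟩), mul_zero]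
  · rw [if_neg hts, if_neg (fun h => hts h.2.2)]

/-- The operator on `A' T C` that Charlie receives, weighted by its probability, when the value of
`T'` is `t'`. -/
def charlieState (M : Bits k → Matrix (RegSub k × B) (RegSub k × B) ℂ) (m : ℕ)
    (Φ : Matrix (Bits (2 * k)) (Bits (2 * k)) ℂ →ₗ[ℂ] Matrix (B × C) (B × C) ℂ) (t' : Bits k) :
    Matrix (RegSub k × Bits k × C) (RegSub k × Bits k × C) ℂ :=
  (charlieView (andGuess M (robustState k m Φ))).submatrix (fun y => (t', y)) (fun y => (t', y))

omit [DecidableEq B] in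
theorem charlieView_posSemidef {T A' T' A C : Type*} [Fintype A]
    {ρ : Matrix (T × (A × B) × (T' × A' × C)) (T × (A × B) × (T' × A' × C)) ℂ}
    (hρ : ρ.PosSemidef) : (charlieView ρ).PosSemidef :=
  traceFst_posSemidef (hρ.submatrix _)

theorem charlieState_posSemidef
    {Φ : Matrix (Bits (2 * k)) (Bits (2 * k)) ℂ →ₗ[ℂ] Matrix (B × C) (B × C) ℂ}
    (hΦ : IsChannel Φ) (M : Bits k → Matrix (RegSub k × B) (RegSub k × B) ℂ) (t' : Bits k) :
    (charlieState M m Φ t').PosSemidef :=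
  (charlieView_posSemidef (andGuess_posSemidef M (robustState_posSemidef hΦ))).submatrix _

theorem charlieView_eq_sum
    (Φ : Matrix (Bits (2 * k)) (Bits (2 * k)) ℂ →ₗ[ℂ] Matrix (B × C) (B × C) ℂ)
    {M : Bits k → Matrix (RegSub k × B) (RegSub k × B) ℂ} (hM : IsPOVM M) :
    charlieView (andGuess M (robustState k m Φ)) =
      ∑ t', pt t' ⊗ₖ charlieState M m Φ t' := by
  ext ⟨t', a, t, c⟩ ⟨s', b, s, d⟩
  rw [Matrix.sum_apply]
  simp only [Matrix.kroneckerMap_apply, pt_apply, charlieState, Matrix.submatrix_apply]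
  by_cases h : t' = s'
  · subst h
    rw [Finset.sum_eq_single t']
    · simp
    · intro x _ hx; simp [hx]
    · simp
  · rw [charlieView_andGuess_apply Φ hM, if_neg (fun h' => h h'.1)]
    refine (Finset.sum_eq_zero fun x _ => ?_).symm
    rw [if_neg (fun h' => h (h'.1.symm.trans h'.2)), zero_mul]

theorem trace_mul_charlieState
    (Φ : Matrix (Bits (2 * k)) (Bits (2 * k)) ℂ →ₗ[ℂ] Matrix (B × C) (B × C) ℂ)
    {M : Bits k → Matrix (RegSub k × B) (RegSub k × B) ℂ} (hM : IsPOVM M)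
    (N : Matrix (RegSub k × Bits k × C) (RegSub k × Bits k × C) ℂ) (t' : Bits k) :
    (N * charlieState M m Φ t').trace = (((gameCount k m)⁻¹ : ℝ) : ℂ) * ∑ u ∈ ball k m, ∑ a, ∑ t,
      ((bobPOVM M a t ⊗ₖ N.submatrix (fun c => (a, t, c)) (fun c => (a, t, c))) *
        Φ (ketbra (cosetState a (t + u) t'))).trace := by
  have h : (N * charlieState M m Φ t').trace = ∑ a, ∑ t, ∑ c, ∑ d,
      N (a, t, c) (a, t, d) * ((((gameCount k m)⁻¹ : ℝ) : ℂ) *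
        traceBob (bobPOVM M a t) (∑ u ∈ ball k m, Φ (ketbra (cosetState a (t + u) t'))) d c) := by
    simp only [Matrix.trace, Matrix.diag_apply, Matrix.mul_apply, Fintype.sum_prod_type,
      charlieState, Matrix.submatrix_apply, charlieView_andGuess_apply Φ hM, true_and]
    refine Finset.sum_congr rfl fun a _ => Finset.sum_congr rfl fun t _ =>
      Finset.sum_congr rfl fun c _ => ?_
    rw [Finset.sum_eq_single a, Finset.sum_eq_single t]
    · simp
    · intro z _ hz; simp [hz]
    · simp
    · intro z _ hz; simp [hz]
    · simp
  have h2 : ∀ a t, ∑ c, ∑ d, N (a, t, c) (a, t, d) * ((((gameCount k m)⁻¹ : ℝ) : ℂ) *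
        traceBob (bobPOVM M a t) (∑ u ∈ ball k m, Φ (ketbra (cosetState a (t + u) t'))) d c) =
      (((gameCount k m)⁻¹ : ℝ) : ℂ) * ∑ u ∈ ball k m,
        ((bobPOVM M a t ⊗ₖ N.submatrix (fun c => (a, t, c)) (fun c => (a, t, c))) *
          Φ (ketbra (cosetState a (t + u) t'))).trace := by
    intro a t
    rw [← Matrix.trace_sum, ← Finset.mul_sum, ← trace_mul_traceBob]
    simp only [Matrix.trace, Matrix.diag_apply, Matrix.mul_apply, Matrix.submatrix_apply,
      Finset.mul_sum]
    exact Finset.sum_congr rfl fun c _ => Finset.sum_congr rfl fun d _ => mul_left_comm _ _ _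
  rw [h]
  simp only [h2, ← Finset.mul_sum]
  congr 1
  rw [Finset.sum_comm (s := ball k m)]
  exact Finset.sum_congr rfl fun a _ => Finset.sum_comm

/-- The sum over `t'`, `a`, `t` and `u` of the guessing weights, bounded for each `u` separately. -/
theorem guessing_value_le
    {Φ : Matrix (Bits (2 * k)) (Bits (2 * k)) ℂ →ₗ[ℂ] Matrix (B × C) (B × C) ℂ}
    (hΦ : IsChannel Φ) {M : Bits k → Matrix (RegSub k × B) (RegSub k × B) ℂ} (hM : IsPOVM M)
    {N : Bits k → Matrix (RegSub k × Bits k × C) (RegSub k × Bits k × C) ℂ} (hN : IsPOVM N) :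
    (∑ t', (N t' * charlieState M m Φ t').trace).re ≤ Real.cos (Real.pi / 8) ^ (2 * k) := by
  simp only [trace_mul_charlieState Φ hM]
  rw [← Finset.mul_sum, Finset.sum_comm, Complex.re_ofReal_mul, Complex.re_sum]
  have hu : ∀ u ∈ ball k m, (∑ t', ∑ a, ∑ t, ((bobPOVM M a t ⊗ₖ
      (N t').submatrix (fun c => (a, t, c)) (fun c => (a, t, c))) *
        Φ (ketbra (cosetState a (t + u) t'))).trace).re ≤
      Fintype.card (RegSub k) * (Real.cos (Real.pi / 8) ^ 2) ^ k * (2 ^ k * 2 ^ k) := by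
    intro u _
    refine le_trans (le_of_eq ?_) (shifted_game_value_le hΦ (M := bobPOVM M)
      (N := fun a t t' => (N t').submatrix (fun c => (a, t, c)) (fun c => (a, t, c)))
      (fun a => hM.submatrix fun _ _ h => (Prod.mk.inj h).2)
      (fun a t => hN.submatrix fun _ _ h => (Prod.mk.inj (Prod.mk.inj h).2).2) u)
    exact congrArg Complex.re
      (Finset.sum_comm.trans (Finset.sum_congr rfl fun a _ => Finset.sum_comm))
  have hA : 0 < (Fintype.card (RegSub k) : ℝ) := by
    rw [card_regSub]
    exact Nat.cast_pos.2 (Nat.choose_pos (Nat.le_mul_of_pos_left k two_pos))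
  have hball : 0 < ((ball k m).card : ℝ) := by
    exact Nat.cast_pos.2 (Finset.card_pos.2 ⟨0, by simp [ball]⟩)
  refine (mul_le_mul_of_nonneg_left (Finset.sum_le_sum hu) ?_).trans (le_of_eq ?_)
  · rw [gameCount]; positivity
  · rw [Finset.sum_const, nsmul_eq_mul, gameCount, card_bits, ← pow_mul]
    push_cast
    field_simp

/-- The dual certificate for Charlie's guessing probability on the event that Bob is right. -/
theorem exists_dominating_charlieView
    {Φ : Matrix (Bits (2 * k)) (Bits (2 * k)) ℂ →ₗ[ℂ] Matrix (B × C) (B × C) ℂ}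
    (hΦ : IsChannel Φ) {M : Bits k → Matrix (RegSub k × B) (RegSub k × B) ℂ} (hM : IsPOVM M) :
    ∃ ω : Matrix (RegSub k × Bits k × C) (RegSub k × Bits k × C) ℂ, ω.PosSemidef ∧
      (((1 : Matrix (Bits k) (Bits k) ℂ) ⊗ₖ ω) -
        charlieView (andGuess M (robustState k m Φ))).PosSemidef ∧
      ω.trace.re ≤ Real.cos (Real.pi / 8) ^ (2 * k) := by
  obtain ⟨N, hN, ω, hω, htr⟩ := exists_isPOVM_dominating (charlieState M m Φ)
    fun t' => (charlieState_posSemidef hΦ M t').isHermitian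
  refine ⟨ω, ?_, ?_, htr.le.trans (guessing_value_le hΦ hM hN)⟩
  · simpa using (hω 0).add (charlieState_posSemidef (m := m) hΦ M 0)
  · have h1 : (1 : Matrix (Bits k) (Bits k) ℂ) = ∑ t', pt t' := by
      ext i j
      simp only [Matrix.sum_apply, pt_apply, Matrix.one_apply, ite_and]
      simp
    rw [h1, charlieView_eq_sum Φ hM, sum_kronecker, ← Finset.sum_sub_distrib]
    refine Matrix.posSemidef_sum _ fun t' _ => ?_
    rw [← kronecker_sub]
    exact (pt_posSemidef t').kronecker (hω t')

end RobustState

/-! ### Entropies -/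

section Entropy

theorem negLg_ne_bot (x : ℝ) : negLg x ≠ ⊥ := by
  rw [negLg]; split_ifs
  · exact top_ne_bot
  · exact EReal.coe_ne_bot _

/-- No positivity of `p` and `g` is needed: `negLg` is `+∞` at nonpositive numbers. -/
theorem le_negLg_add_negLg {p g y : ℝ} (h : p * g ≤ y) :
    ((-Real.logb 2 y : ℝ) : EReal) ≤ negLg p + negLg g := by
  by_cases hp : p ≤ 0
  · rw [negLg, if_pos hp, EReal.top_add_of_ne_bot (negLg_ne_bot g)]
    exact le_top
  by_cases hg : g ≤ 0
  · rw [add_comm, negLg, if_pos hg, EReal.top_add_of_ne_bot (negLg_ne_bot p)]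
    exact le_top
  push Not at hp hg
  rw [negLg, negLg, if_neg hp.not_ge, if_neg hg.not_ge, ← EReal.coe_add, EReal.coe_le_coe_iff,
    ← neg_add, ← Real.logb_mul hp.ne' hg.ne', neg_le_neg_iff]
  exact Real.logb_le_logb_of_le one_lt_two (mul_pos hp hg) h

/-- The uncertainty relation with the bound `-2k lg cos(π/8)`. -/
theorem hMinMeas_add_hMin_ge {k m : ℕ} {B C : Type*} [Fintype B] [DecidableEq B] [Fintype C]
    [DecidableEq C] {Φ : Matrix (Bits (2 * k)) (Bits (2 * k)) ℂ →ₗ[ℂ] Matrix (B × C) (B × C) ℂ}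
    (hΦ : IsChannel Φ) {M : Bits k → Matrix (RegSub k × B) (RegSub k × B) ℂ} (hM : IsPOVM M) :
    ((-Real.logb 2 (Real.cos (Real.pi / 8) ^ (2 * k)) : ℝ) : EReal) ≤
      hMinMeas M (robustState k m Φ) + hMin (charlieView (condGuess M (robustState k m Φ))) := by
  obtain ⟨ω, hω, hdom, htr⟩ := exists_dominating_charlieView (m := m) hΦ hM
  rw [hMinMeas, hMin]
  refine le_negLg_add_negLg ?_
  set G := andGuess M (robustState k m Φ) with hG
  have hG0 : 0 ≤ G.trace := (andGuess_posSemidef M (robustState_posSemidef hΦ)).trace_nonneg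
  have hre : G.trace = ((G.trace.re : ℝ) : ℂ) :=
    Complex.ext rfl (Complex.nonneg_iff.1 hG0).2.symm
  set p := G.trace.re with hp
  have hp0 : 0 ≤ p := (Complex.nonneg_iff.1 hG0).1
  -- If the event has probability zero, its entropy is already `+∞`.
  rcases hp0.eq_or_lt with h0 | hpos
  · rw [← h0, zero_mul]
    exact (even_two_mul k).pow_nonneg _
  have hview : charlieView (condGuess M (robustState k m Φ)) = (p⁻¹ : ℝ) • charlieView G := by
    rw [condGuess, ← hG, hre, ← Complex.ofReal_inv]
    ext i j
    simp only [charlieView, traceFst, Matrix.submatrix_apply, Matrix.smul_apply, smul_eq_mul,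
      Complex.real_smul, Finset.mul_sum]
  refine le_trans ?_ htr
  rw [mul_comm, ← le_div_iff₀ hpos]
  -- Rescaled by the probability of the event, `ω` is feasible for the conditional state.
  refine csInf_le ⟨0, ?_⟩ ⟨p⁻¹ • ω, ?_, ?_, ?_⟩
  · rintro r ⟨ω', hω', -, rfl⟩
    exact (Complex.nonneg_iff.1 hω'.trace_nonneg).1
  · exact hω.smul (inv_nonneg.2 hp0)
  · rw [hview, Matrix.kronecker_smul, ← smul_sub]
    exact hdom.smul (inv_nonneg.2 hp0)
  · rw [Matrix.trace_smul, Complex.real_smul, Complex.re_ofReal_mul, div_eq_inv_mul]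

end Entropy

end LeakyMoE

end

theorem mainTheorem5 (k : ℕ) (hk : 0 < k) (m : ℕ)
    {B C : Type*} [Fintype B] [DecidableEq B] [Fintype C] [DecidableEq C]
    (Φ : Matrix (LeakyMoE.Bits (2 * k)) (LeakyMoE.Bits (2 * k)) ℂ →ₗ[ℂ]
      Matrix (B × C) (B × C) ℂ)
    (hΦ : LeakyMoE.IsChannel Φ)
    (M : LeakyMoE.Bits k → Matrix (LeakyMoE.RegSub k × B) (LeakyMoE.RegSub k × B) ℂ)
    (hM : LeakyMoE.IsPOVM M) :
    (((-Real.logb 2 (Real.cos (Real.pi / 8)) - 1 / ((2 * Real.log 2) * ((2 * k : ℕ) : ℝ))) *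
        ((2 * k : ℕ) : ℝ) : ℝ) : EReal) ≤
      LeakyMoE.hMinMeas M (LeakyMoE.robustState k m Φ) +
        LeakyMoE.hMin
          (LeakyMoE.charlieView (LeakyMoE.condGuess M (LeakyMoE.robustState k m Φ))) := by
  refine le_trans (EReal.coe_le_coe_iff.2 ?_) (LeakyMoE.hMinMeas_add_hMin_ge (m := m) hΦ hM)
  have hn : (0 : ℝ) < ((2 * k : ℕ) : ℝ) := by exact_mod_cast Nat.mul_pos two_pos hk
  have hl : 0 < Real.log 2 := Real.log_pos one_lt_two
  have h1 : 0 ≤ 1 / ((2 * Real.log 2) * ((2 * k : ℕ) : ℝ)) := by positivity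
  rw [Real.logb_pow]
  nlinarith
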